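/- Let $S_\infty$ be the group of permutations $w$ of $\{1,2,3,\dots\}$ with $w(i)=i$ for almost all $i$, and let $S_n\subset S_\infty$ be the subgroup of those $w$ that fix all $i>n$. Let $\ell(w)$ be the number of inversions of $w$, let $s_{ij}$ be the transposition of $i$ and $j$, let $s_i=s_{i,i+1}$, and let $w_\circ=n\cdots 2\,1$ be the longest element of $S_n$. For $w\in S_n$ the Schubert polynomial is $$\mathfrak S_w=A_{w^{-1}w_\circ}\bigl(x_1^{n-1}x_2^{n-2}\cdots x_{n-1}\bigr),$$ where $A_i f=\dfrac{f-s_i f}{x_i-x_{i+1}}$ and $A_v=A_{i_1}\cdots A_{i_l}$ for a reduced decomposition $v=s_{i_1}\cdots s_{i_l}$; it depends neither on the reduced decomposition nor on the choice of $n$ with $w\in S_n$, so $\mathfrak S_w$ is defined for every $w\in S_\infty$. Let $\mathbb N^\infty$ be the set of sequences $a=(a_1,a_2,\dots)$ of nonnegative integers with finitely many nonzero terms, and $\mathbb N^n\subset\mathbb N^\infty$ the set of those with $a_i=0$ for $i>n$. The Schubert–Kostka matrix $K=(K_{w,a})_{w\in S_\infty,\,a\in\mathbb N^\infty}$ is defined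 by $\mathfrak S_w=\sum_a K_{w,a}\,x^a$. For $w\in S_n$ let $$\mathfrak D_w=\frac1{\ell(w)!}\sum_C m_C(y)\in\mathbb Q[y_1,\dots,y_n],$$ where the sum is over all saturated chains $C=(\mathrm{id}=u_0\lessdot u_1\lessdot\cdots\lessdot u_l=w)$, $l=\ell(w)$, in the strong Bruhat order on $S_n$, and $m_C(y)$ is the product of the weights of the edges of $C$, the weight of $u\lessdot u s_{ij}$ with $i<j$ being $y_i-y_j$. Write $y^{(a)}=\prod_i y_i^{a_i}/a_i!$ for $a\in\mathbb N^\infty$. Let $w\in S_n$ be $312$-avoiding, that is, there are no $i<j<k\le n$ with $w_i>w_k>w_j$. Let $c=\mathrm{code}(w_\circ w)\in\mathbb N^n$, where $\mathrm{code}(v)_i=\#\{j\mid i<j\le n,\ v_j<v_i\}$, and let $\rho=(n-1,n-2,\dots,0)$, on which $u\in S_n$ acts by permuting coordinates, $u(\rho)_i=\rho_{u^{-1}(i)}$. Then the matrix $K$ has a unique inverse $K^{-1}=(K^{-1}_{a,w})$ among the matrices with finitely supported rows, and: 1. for every $a=(a_1,\dots,a_n)\in\mathbb N^n$, $$K^{-1}_{a,w}=\begin{cases}(-1)^{\ell(u)}&\text{if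 }a+c=u(\rho)\text{ for some }u\in S_n,\\ 0&\text{otherwise;}\end{cases}$$ 2. the numbers $K^{-1}_{a,w}$ are the coefficients of $\mathfrak D_w$ in the basis $\{y^{(a)}\}$: only finitely many of them, $a\in\mathbb N^\infty$, are nonzero, and $$\mathfrak D_w=\sum_{a\in\mathbb N^\infty}K^{-1}_{a,w}\,y^{(a)}.$$ -/

import Mathlib

open MvPolynomial

noncomputable section

namespace SchubertKostka

/-! Positions, values and variables are numbered from `0`: the number `i : ℕ` stands for the
position (or value) `i + 1`, and `X i` for the variable with index `i + 1`. -/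

/-- The group `S_∞` of permutations of `{1, 2, …}` that fix almost all points. -/
def SInf : Subgroup (Equiv.Perm ℕ) where
  carrier := {w | ∃ n, ∀ i, n ≤ i → w i = i}
  one_mem' := ⟨0, fun _ _ => rfl⟩
  mul_mem' := by
    rintro a b ⟨m, hm⟩ ⟨n, hn⟩
    refine ⟨max m n, fun i hi => ?_⟩
    rw [Equiv.Perm.mul_apply, hn i (le_trans (le_max_right _ _) hi),
      hm i (le_trans (le_max_left _ _) hi)]
  inv_mem' := by
    rintro a ⟨m, hm⟩
    exact ⟨m, fun i hi => by rw [Equiv.Perm.inv_eq_iff_eq, hm i hi]⟩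

/-- `w ∈ S_n`, where `S_n ⊆ S_∞` is the subgroup of permutations that fix all points `> n`. -/
def InSn (n : ℕ) (w : SInf) : Prop := ∀ i, n ≤ i → w.1 i = i

/-- The transposition of `i` and `j`. -/
def transp (i j : ℕ) : SInf :=
  ⟨Equiv.swap i j, max i j + 1, fun k hk => Equiv.swap_apply_of_ne_of_ne (by omega) (by omega)⟩

/-- The adjacent transposition `s_i`. -/
def simpleRefl (i : ℕ) : SInf := transp i (i + 1)

/-- The longest permutation `n, n-1, …, 1` of `S_n`. -/
def longest (n : ℕ) : SInf :=
  ⟨Function.Involutive.toPerm (fun i => if i < n then n - 1 - i else i) (by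
      intro i
      by_cases h : i < n
      · have h' : n - 1 - i < n := by omega
        simp only [h, h', if_true]
        omega
      · simp only [h, if_false]),
    n, fun i hi => if_neg (not_lt.mpr hi)⟩

/-- The length `ℓ(w)`: the number of inversions. -/
def len (w : SInf) : ℕ := {p : ℕ × ℕ | p.1 < p.2 ∧ w.1 p.2 < w.1 p.1}.ncard

/-- `w ∈ S_n` is 312-avoiding: there are no `i < j < k ≤ n` with `w_i > w_k > w_j`. -/
def Avoids312 (n : ℕ) (w : SInf) : Prop :=
  ¬ ∃ i j k, i < j ∧ j < k ∧ k < n ∧ w.1 j < w.1 k ∧ w.1 k < w.1 i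

/-- The code of `w ∈ S_n`: `c_i = #{j | i < j ≤ n, w_j < w_i}`. -/
def code (n : ℕ) (w : SInf) (i : ℕ) : ℕ :=
  ((Finset.range n).filter fun j => i < j ∧ w.1 j < w.1 i).card

/-- `ρ = (n-1, n-2, …, 0)`. -/
def rho (n : ℕ) (i : ℕ) : ℕ := n - 1 - i

/-! ### Divided differences and Schubert polynomials -/

theorem sub_rename_swap_dvd (i : ℕ) (f : MvPolynomial ℕ ℚ) :
    (X i - X (i + 1) : MvPolynomial ℕ ℚ) ∣ f - rename (Equiv.swap i (i + 1)) f := by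
  induction f using MvPolynomial.induction_on with
  | C a => simp
  | add p q hp hq =>
    have h : p + q - rename (Equiv.swap i (i + 1)) (p + q)
        = (p - rename (Equiv.swap i (i + 1)) p) + (q - rename (Equiv.swap i (i + 1)) q) := by
      rw [map_add]; ring
    rw [h]; exact dvd_add hp hq
  | mul_X p k hp =>
    have h : p * X k - rename (Equiv.swap i (i + 1)) (p * X k)
        = (p - rename (Equiv.swap i (i + 1)) p) * X k
          + rename (Equiv.swap i (i + 1)) p * (X k - X (Equiv.swap i (i + 1) k)) := by
      rw [map_mul, rename_X]; ring
    rw [h]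
    refine dvd_add (Dvd.dvd.mul_right hp _) (Dvd.dvd.mul_left ?_ _)
    rcases eq_or_ne k i with rfl | h1
    · rw [Equiv.swap_apply_left]
    · rcases eq_or_ne k (i + 1) with rfl | h2
      · rw [Equiv.swap_apply_right]
        exact ⟨-1, by ring⟩
      · rw [Equiv.swap_apply_of_ne_of_ne h1 h2, sub_self]
        exact dvd_zero _

/-- The divided difference operator `A_i f = (f - s_i f) / (x_i - x_{i+1})`. -/
def divDiff (i : ℕ) (f : MvPolynomial ℕ ℚ) : MvPolynomial ℕ ℚ :=
  (sub_rename_swap_dvd i f).choose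

/-- `s_{i_1} ⋯ s_{i_l}` is a reduced decomposition of `w`: a decomposition into adjacent
transpositions of minimal length. -/
def IsReducedWord (w : SInf) (l : List ℕ) : Prop :=
  (l.map simpleRefl).prod = w ∧
    ∀ l' : List ℕ, (l'.map simpleRefl).prod = w → l.length ≤ l'.length

theorem exists_word_transp (i d : ℕ) :
    ∃ l : List ℕ, (l.map fun k => Equiv.swap k (k + 1)).prod = Equiv.swap i (i + d) := by
  induction d with
  | zero => exact ⟨[], by simp [Equiv.Perm.one_def]⟩
  | succ d ih =>
    obtain ⟨l, hl⟩ := ih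
    rcases Nat.eq_zero_or_pos d with rfl | hd
    · exact ⟨[i], by simp⟩
    · refine ⟨[i + d] ++ l ++ [i + d], ?_⟩
      simp only [List.map_append, List.prod_append, List.map_cons, List.map_nil,
        List.prod_cons, List.prod_nil, mul_one, hl]
      have h := Equiv.swap_mul_swap_mul_swap (x := i) (y := i + d) (z := i + d + 1)
        (by omega) (by omega)
      rw [Equiv.swap_comm (i + d + 1) i] at h
      rw [h]
      rfl

theorem exists_word (w : SInf) : ∃ l : List ℕ, (l.map simpleRefl).prod = w := by
  have key : ∃ l : List ℕ, (l.map fun k => Equiv.swap k (k + 1)).prod = w.1 := by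
    have hw : w.1 ∈ Subgroup.closure {σ : Equiv.Perm ℕ | σ.IsSwap} := by
      rw [mem_closure_isSwap']
      obtain ⟨n, hn⟩ := w.2
      refine (Set.finite_lt_nat n).subset fun i hi => ?_
      by_contra h
      exact hi (hn i (not_lt.mp h))
    generalize w.1 = v at hw
    induction hw using Subgroup.closure_induction with
    | mem x hx =>
      obtain ⟨i, j, -, rfl⟩ := hx
      rcases le_total i j with h | h
      · obtain ⟨d, rfl⟩ := Nat.exists_eq_add_of_le h
        exact exists_word_transp i d
      · obtain ⟨d, rfl⟩ := Nat.exists_eq_add_of_le h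
        rw [Equiv.swap_comm]
        exact exists_word_transp j d
    | one => exact ⟨[], rfl⟩
    | mul x y _ _ hx hy =>
      obtain ⟨l, rfl⟩ := hx
      obtain ⟨m, rfl⟩ := hy
      exact ⟨l ++ m, by simp⟩
    | inv x _ hx =>
      obtain ⟨l, rfl⟩ := hx
      refine ⟨l.reverse, ?_⟩
      rw [List.prod_inv_reverse, List.map_reverse, List.map_map]
      congr 2
  obtain ⟨l, hl⟩ := key
  refine ⟨l, Subtype.ext ?_⟩
  rw [← hl, ← Subgroup.coe_subtype, map_list_prod, List.map_map]
  rfl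

theorem exists_reducedWord (w : SInf) : ∃ l, IsReducedWord w l := by
  classical
  have h : ∃ m, ∃ l : List ℕ, (l.map simpleRefl).prod = w ∧ l.length = m :=
    let ⟨l, hl⟩ := exists_word w
    ⟨l.length, l, hl, rfl⟩
  obtain ⟨l, hl, hm⟩ := Nat.find_spec h
  exact ⟨l, hl, fun l' hl' => hm ▸ Nat.find_min' h ⟨l', hl', rfl⟩⟩

/-- The operator `A_w = A_{i_1} ⋯ A_{i_l}`, for a reduced decomposition `w = s_{i_1} ⋯ s_{i_l}`
(the operator does not depend on the choice of the decomposition). -/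
def divDiffPerm (w : SInf) (f : MvPolynomial ℕ ℚ) : MvPolynomial ℕ ℚ :=
  (exists_reducedWord w).choose.foldr divDiff f

/-- The Schubert polynomial of `w`, regarded as an element of `S_n`:
`A_{w⁻¹ w_∘}(x_1^{n-1} x_2^{n-2} ⋯ x_{n-1})`. -/
def schubertIn (n : ℕ) (w : SInf) : MvPolynomial ℕ ℚ :=
  divDiffPerm (w⁻¹ * longest n) (∏ i ∈ Finset.range n, X i ^ rho n i)

open Classical in
/-- The Schubert polynomial of `w ∈ S_∞`, computed in the smallest `S_n` that contains `w`
(by stability, every `S_n` that contains `w` gives the same polynomial). -/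
def schubert (w : SInf) : MvPolynomial ℕ ℚ := schubertIn (Nat.find w.2) w

/-! ### The Schubert-Kostka matrix and its inverse -/

/-- The Schubert-Kostka matrix: `𝔖_w = ∑_a K_{w,a} x^a`. -/
def kostka (w : SInf) (a : ℕ →₀ ℕ) : ℚ := coeff a (schubert w)

open Classical in
/-- `L` is the inverse matrix `K⁻¹ = (K⁻¹_{a,w})` of the Schubert-Kostka matrix.  All rows of
`K` and of `L` have finite support, so both matrix products are finite sums. -/
structure IsInverseKostka (L : (ℕ →₀ ℕ) → (SInf →₀ ℚ)) : Prop where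
  inv_mul : ∀ a b : ℕ →₀ ℕ,
    ∑ w ∈ (L a).support, L a w * kostka w b = if a = b then 1 else 0
  mul_inv : ∀ v w : SInf,
    ∑ a ∈ (schubert v).support, kostka v a * L a w = if v = w then 1 else 0

/-! ### Degree polynomials -/

/-- The covering relation `u ⋖ v` of the (strong) Bruhat order. -/
def Covers (u v : SInf) : Prop :=
  (∃ i j, i < j ∧ v = u * transp i j) ∧ len v = len u + 1

/-- The weight `y_i - y_j` of the edge `u ⋖ v = u s_{ij}`, `i < j`
(for such `u` and `v` there is exactly one pair in the sum). -/
def edgeWeight (u v : SInf) : MvPolynomial ℕ ℚ :=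
  ∑ᶠ p ∈ {p : ℕ × ℕ | p.1 < p.2 ∧ v = u * transp p.1 p.2}, (X p.1 - X p.2)

/-- The saturated chains `id = u_0 ⋖ u_1 ⋖ ⋯ ⋖ u_l = w` in the Bruhat order on `S_n`,
where `l = ℓ(w)`.  This set is finite, because `S_n` is finite. -/
def chains (n : ℕ) (w : SInf) : Set (Fin (len w + 1) → SInf) :=
  {c | (∀ k, InSn n (c k)) ∧ c 0 = 1 ∧ c (Fin.last (len w)) = w ∧
    ∀ k : Fin (len w), Covers (c k.castSucc) (c k.succ)}

/-- The polynomial `𝔇_w` of `w ∈ S_n`: the sum of the weights of all saturated chains from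
the identity to `w`, divided by `ℓ(w)!`. -/
def degPoly (n : ℕ) (w : SInf) : MvPolynomial ℕ ℚ :=
  C (1 / ((len w).factorial : ℚ)) *
    ∑ᶠ c ∈ chains n w, ∏ k : Fin (len w), edgeWeight (c k.castSucc) (c k.succ)

/-- `y^{(a)} = (y_1^{a_1} / a_1!) (y_2^{a_2} / a_2!) ⋯`. -/
def divPow (a : ℕ →₀ ℕ) : MvPolynomial ℕ ℚ :=
  a.prod fun i m => C (1 / (m.factorial : ℚ)) * X i ^ m

end SchubertKostka

end

open SchubertKostka

namespace SchubertKostka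

/-! ### Divided differences -/

/-! Everything is read off from the functionals `ctLin w`, which send `f` to the constant term of
`A_w f`.

Duality: `A_v A_{w⁻¹w_∘}` is `A_{vw⁻¹w_∘}` or zero. For degree reasons the constant term of
`A_{vw⁻¹w_∘} x^ρ` can be nonzero only when `vw⁻¹w_∘` has the length of `w_∘`, that is, when `v = w`.
Hence `ctLin v (𝔖_w) = δ_{vw}` (`ctLin_schubert`). Only finitely many functionals are nonzero on a
given polynomial (`finite_ctLin_ne_zero`), and together they separate polynomials
(`eq_zero_of_forall_ctLin`). So every polynomial expands uniquely in Schubert polynomials, and the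
inverse matrix is `K⁻¹_{a,w} = ctLin w (x^a)`.

Signed formula: for the pairing `(f, g) ↦ ctLin w_∘ (f g)` the adjoint of `A_w` is `A_{w⁻¹}`, and
pairing with `x^ρ` takes constant terms. Therefore `ctLin w f = ctLin w_∘ (f · A_{w⁻¹} x^ρ)`
(`ctLin_eq_ctLin_longest`). If `w` avoids 312, then `A_{w⁻¹} x^ρ` is the single monomial `x^c`
(`divDiffPerm_inv_xPow_rho`), so the entry equals `ctLin w_∘ (x^{a+c})`. This last functional is
antisymmetric under `S_n` and lives in the degree of `x^ρ`. It thus vanishes unless the exponents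
are a rearrangement of `ρ`, and then it gives the sign.

Degree polynomials: the Leibniz rule for `A_w` (`divDiffPerm_mul_X`) shows that multiplying by `∑
y_i x_i` before applying `ctLin w` amounts to stepping down one Bruhat cover with weight `y_i -
y_j`. Iterating, the weighted chain sum is `ctLin w ((∑ y_i x_i)^l)` (`eval_chainSum`), and the
multinomial theorem turns this into divided powers. No pattern avoidance enters here. -/

theorem X_sub_X_ne_zero {i j : ℕ} (h : i ≠ j) : (X i - X j : MvPolynomial ℕ ℚ) ≠ 0 :=
  sub_ne_zero.mpr fun h' => h (X_injective h')

theorem divDiff_spec (i : ℕ) (f : MvPolynomial ℕ ℚ) :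
    (X i - X (i + 1)) * divDiff i f = f - rename (Equiv.swap i (i + 1)) f :=
  (sub_rename_swap_dvd i f).choose_spec.symm

theorem divDiff_eq_of_mul_eq {i : ℕ} {f g : MvPolynomial ℕ ℚ}
    (h : (X i - X (i + 1)) * g = f - rename (Equiv.swap i (i + 1)) f) : divDiff i f = g :=
  mul_left_cancel₀ (X_sub_X_ne_zero (Nat.succ_ne_self i).symm) ((divDiff_spec i f).trans h.symm)

@[simp] theorem divDiff_add (i : ℕ) (f g : MvPolynomial ℕ ℚ) :
    divDiff i (f + g) = divDiff i f + divDiff i g :=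
  divDiff_eq_of_mul_eq (by rw [mul_add, divDiff_spec, divDiff_spec, map_add]; ring)

@[simp] theorem divDiff_C_mul (i : ℕ) (c : ℚ) (f : MvPolynomial ℕ ℚ) :
    divDiff i (C c * f) = C c * divDiff i f :=
  divDiff_eq_of_mul_eq (by rw [mul_left_comm, divDiff_spec, map_mul, rename_C]; ring)

@[simp] theorem divDiff_neg (i : ℕ) (f : MvPolynomial ℕ ℚ) :
    divDiff i (-f) = -divDiff i f :=
  divDiff_eq_of_mul_eq (by rw [mul_neg, divDiff_spec, map_neg]; ring)

@[simp] theorem divDiff_sub (i : ℕ) (f g : MvPolynomial ℕ ℚ) :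
    divDiff i (f - g) = divDiff i f - divDiff i g := by
  rw [sub_eq_add_neg, divDiff_add, divDiff_neg, sub_eq_add_neg]

@[simp] theorem divDiff_C (i : ℕ) (c : ℚ) : divDiff i (C c) = 0 :=
  divDiff_eq_of_mul_eq (by simp)

@[simp] theorem divDiff_zero (i : ℕ) : divDiff i 0 = 0 :=
  divDiff_eq_of_mul_eq (by simp)

theorem divDiff_eq_zero_iff {i : ℕ} {f : MvPolynomial ℕ ℚ} :
    divDiff i f = 0 ↔ rename (Equiv.swap i (i + 1)) f = f := by
  constructor
  · intro h
    have := divDiff_spec i f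
    rw [h, mul_zero] at this
    exact (sub_eq_zero.mp this.symm).symm
  · intro h
    exact divDiff_eq_of_mul_eq (by rw [h]; ring)

theorem rename_swap_divDiff (i : ℕ) (f : MvPolynomial ℕ ℚ) :
    rename (Equiv.swap i (i + 1)) (divDiff i f) = divDiff i f := by
  have h := congrArg (rename (Equiv.swap i (i + 1))) (divDiff_spec i f)
  rw [map_mul, map_sub, map_sub, rename_X, rename_X, Equiv.swap_apply_left,
    Equiv.swap_apply_right, rename_rename, ← Equiv.coe_trans, Equiv.swap_swap,
    Equiv.coe_refl, rename_id_apply] at h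
  refine (divDiff_eq_of_mul_eq ?_).symm
  linear_combination -h

@[simp] theorem divDiff_divDiff (i : ℕ) (f : MvPolynomial ℕ ℚ) :
    divDiff i (divDiff i f) = 0 :=
  divDiff_eq_zero_iff.mpr (rename_swap_divDiff i f)

theorem divDiff_mul (i : ℕ) (f g : MvPolynomial ℕ ℚ) :
    divDiff i (f * g) = rename (Equiv.swap i (i + 1)) f * divDiff i g + divDiff i f * g :=
  divDiff_eq_of_mul_eq (by
    rw [map_mul]
    linear_combination rename (Equiv.swap i (i + 1)) f * divDiff_spec i g
      + g * divDiff_spec i f)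

theorem divDiff_divDiff_mul (i : ℕ) (f g : MvPolynomial ℕ ℚ) :
    divDiff i (divDiff i f * g) = divDiff i f * divDiff i g := by
  rw [divDiff_mul, rename_swap_divDiff, divDiff_divDiff, zero_mul, add_zero]

theorem divDiff_mul_divDiff (i : ℕ) (f g : MvPolynomial ℕ ℚ) :
    divDiff i (f * divDiff i g) = divDiff i f * divDiff i g := by
  rw [mul_comm, divDiff_divDiff_mul, mul_comm]

theorem divDiff_rename_swap (i : ℕ) (f : MvPolynomial ℕ ℚ) :
    divDiff i (rename (Equiv.swap i (i + 1)) f) = -divDiff i f := by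
  refine divDiff_eq_of_mul_eq ?_
  rw [rename_rename, ← Equiv.coe_trans, Equiv.swap_swap, Equiv.coe_refl, rename_id_apply]
  linear_combination -divDiff_spec i f

theorem divDiff_X (i k : ℕ) :
    divDiff i (X k) = C ((if k = i then 1 else 0) - (if k = i + 1 then 1 else 0)) := by
  refine divDiff_eq_of_mul_eq ?_
  rw [rename_X]
  rcases eq_or_ne k i with rfl | h1
  · simp
  · rcases eq_or_ne k (i + 1) with rfl | h2
    · simp
    · simp [h1, h2, Equiv.swap_apply_of_ne_of_ne]

theorem divDiff_mul_X (i k : ℕ) (f : MvPolynomial ℕ ℚ) :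
    divDiff i (f * X k) = divDiff i f * X (Equiv.swap i (i + 1) k)
      + C ((if k = i then 1 else 0) - (if k = i + 1 then 1 else 0)) * f := by
  rw [mul_comm, divDiff_mul, divDiff_X, rename_X]; ring

theorem divDiff_mul_X_left (i : ℕ) (f : MvPolynomial ℕ ℚ) :
    divDiff i (f * X i) = divDiff i f * X (i + 1) + f := by
  rw [divDiff_mul_X]; simp

theorem divDiff_mul_X_right (i : ℕ) (f : MvPolynomial ℕ ℚ) :
    divDiff i (f * X (i + 1)) = divDiff i f * X i - f := by
  rw [divDiff_mul_X]; simp; ring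

theorem divDiff_mul_X_of_ne {i k : ℕ} (h1 : k ≠ i) (h2 : k ≠ i + 1) (f : MvPolynomial ℕ ℚ) :
    divDiff i (f * X k) = divDiff i f * X k := by
  rw [divDiff_mul_X, Equiv.swap_apply_of_ne_of_ne h1 h2]; simp [h1, h2]

/-- By the Leibniz rule both composites obey the same recursion under multiplication by a variable,
so induction on `f` suffices. The case split asks which of the two operators moves that variable. -/
theorem divDiff_comm {i j : ℕ} (h : i + 2 ≤ j) (f : MvPolynomial ℕ ℚ) :
    divDiff i (divDiff j f) = divDiff j (divDiff i f) := by
  induction f using MvPolynomial.induction_on with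
  | C a => simp
  | add p q hp hq => simp only [divDiff_add, hp, hq]
  | mul_X p k hp =>
    by_cases h1 : k = i
    · subst h1
      rw [divDiff_mul_X_of_ne (by omega) (by omega), divDiff_mul_X_left, divDiff_mul_X_left,
        divDiff_add, divDiff_mul_X_of_ne (by omega) (by omega), hp]
    by_cases h2 : k = i + 1
    · subst h2
      rw [divDiff_mul_X_of_ne (by omega) (by omega), divDiff_mul_X_right, divDiff_mul_X_right,
        divDiff_sub, divDiff_mul_X_of_ne (by omega) (by omega), hp]
    by_cases h3 : k = j
    · subst h3
      rw [divDiff_mul_X_of_ne h1 h2, divDiff_mul_X_left, divDiff_mul_X_left, divDiff_add,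
        divDiff_mul_X_of_ne (by omega) (by omega), hp]
    by_cases h4 : k = j + 1
    · subst h4
      rw [divDiff_mul_X_of_ne h1 h2, divDiff_mul_X_right, divDiff_mul_X_right, divDiff_sub,
        divDiff_mul_X_of_ne (by omega) (by omega), hp]
    rw [divDiff_mul_X_of_ne h1 h2, divDiff_mul_X_of_ne h3 h4, divDiff_mul_X_of_ne h3 h4,
      divDiff_mul_X_of_ne h1 h2, hp]

/-- Same method as `divDiff_comm`; the lower-order Leibniz terms either cancel or contain a square
`A_i A_i = 0`. -/
theorem divDiff_braid (i : ℕ) (f : MvPolynomial ℕ ℚ) :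
    divDiff i (divDiff (i + 1) (divDiff i f))
      = divDiff (i + 1) (divDiff i (divDiff (i + 1) f)) := by
  induction f using MvPolynomial.induction_on with
  | C a =>
    simp
  | add p q hp hq => simp only [divDiff_add, hp, hq]
  | mul_X p k hp =>
    have e1 : ∀ g, divDiff i (g * X (i + 2)) = divDiff i g * X (i + 2) :=
      divDiff_mul_X_of_ne (by omega) (by omega)
    have e2 : ∀ g, divDiff (i + 1) (g * X i) = divDiff (i + 1) g * X i :=
      divDiff_mul_X_of_ne (by omega) (by omega)
    have e3 : ∀ g, divDiff (i + 1) (g * X (i + 2)) = divDiff (i + 1) g * X (i + 1) - g :=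
      divDiff_mul_X_right (i + 1)
    have e4 : ∀ g, divDiff (i + 1) (g * X (i + 1)) = divDiff (i + 1) g * X (i + 2) + g :=
      divDiff_mul_X_left (i + 1)
    by_cases h1 : k = i
    · subst h1
      simp only [divDiff_mul_X_left, e1, e2, e4, divDiff_add, divDiff_divDiff, hp]
      ring
    by_cases h2 : k = i + 1
    · subst h2
      simp only [divDiff_mul_X_left, divDiff_mul_X_right, e1, e2, e3, e4, divDiff_add,
        divDiff_sub, hp]
      ring
    by_cases h3 : k = i + 2
    · subst h3
      simp only [divDiff_mul_X_right, e1, e2, e3, divDiff_sub, divDiff_divDiff, hp]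
      ring
    have e5 : ∀ g, divDiff i (g * X k) = divDiff i g * X k := divDiff_mul_X_of_ne h1 h2
    have e6 : ∀ g, divDiff (i + 1) (g * X k) = divDiff (i + 1) g * X k :=
      divDiff_mul_X_of_ne h2 h3
    simp only [e5, e6, hp]

/-- This makes induction on the degree possible in `finite_ctLin_ne_zero` and
`eq_zero_of_forall_ctLin`. -/
theorem totalDegree_divDiff_lt {i : ℕ} {f : MvPolynomial ℕ ℚ} (h : divDiff i f ≠ 0) :
    (divDiff i f).totalDegree < f.totalDegree := by
  have h1 : (X i - X (i + 1) : MvPolynomial ℕ ℚ).totalDegree = 1 := by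
    have hX : (X i - X (i + 1) : MvPolynomial ℕ ℚ).IsHomogeneous 1 :=
      (isHomogeneous_X ℚ i).sub (isHomogeneous_X ℚ (i + 1))
    exact hX.totalDegree (X_sub_X_ne_zero (Nat.succ_ne_self i).symm)
  have h2 := totalDegree_mul_of_isDomain (X_sub_X_ne_zero (Nat.succ_ne_self i).symm) h
  rw [divDiff_spec, h1] at h2
  have h3 := totalDegree_sub f (rename (Equiv.swap i (i + 1)) f)
  have h4 := totalDegree_rename_le (Equiv.swap i (i + 1)) f
  have h5 := max_le (le_refl f.totalDegree) h4
  omega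

theorem exists_divDiff_eq_zero (f : MvPolynomial ℕ ℚ) : ∃ m, ∀ i, m ≤ i → divDiff i f = 0 := by
  induction f using MvPolynomial.induction_on with
  | C a => exact ⟨0, fun i _ => divDiff_C i a⟩
  | add p q hp hq =>
    obtain ⟨m, hm⟩ := hp
    obtain ⟨m', hm'⟩ := hq
    refine ⟨max m m', fun i hi => ?_⟩
    rw [divDiff_add, hm i (by omega), hm' i (by omega), add_zero]
  | mul_X p k hp =>
    obtain ⟨m, hm⟩ := hp
    refine ⟨max m (k + 1), fun i hi => ?_⟩
    rw [divDiff_mul_X_of_ne (by omega) (by omega), hm i (by omega), zero_mul]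

/-- A polynomial in infinitely many variables that is killed by all divided differences is
symmetric, hence constant. -/
theorem eq_C_of_forall_divDiff_eq_zero {f : MvPolynomial ℕ ℚ} (h : ∀ i, divDiff i f = 0) :
    f = C (constantCoeff f) := by
  -- Symmetry propagates an occurring variable to the next one, so a finite set of variables must be
  -- empty.
  have hs : ∀ i, i ∈ f.vars → i + 1 ∈ f.vars := by
    intro i hi
    have h1 := vars_rename (Equiv.swap i (i + 1)) f
    rw [divDiff_eq_zero_iff.mp (h i)] at h1
    obtain ⟨j, hj, hji⟩ := Finset.mem_image.mp (h1 hi)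
    rw [Equiv.swap_apply_eq_iff, Equiv.swap_apply_left] at hji
    exact hji ▸ hj
  have hv : f.vars = ∅ := by
    by_contra hne
    have hmem := f.vars.max'_mem (Finset.nonempty_iff_ne_empty.mpr hne)
    have := f.vars.le_max' _ (hs _ hmem)
    omega
  exact vars_eq_empty_iff_eq_C.mp hv

/-! ### Inversions and length -/

theorem SInf.mul_apply (u v : SInf) (i : ℕ) : (u * v).1 i = u.1 (v.1 i) := rfl

theorem SInf.inv_apply_self (u : SInf) (i : ℕ) : (u⁻¹).1 (u.1 i) = i :=
  Equiv.symm_apply_apply u.1 i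

theorem SInf.apply_inv_self (u : SInf) (i : ℕ) : u.1 ((u⁻¹).1 i) = i :=
  Equiv.apply_symm_apply u.1 i

theorem SInf.ext_apply {u v : SInf} (h : ∀ i, u.1 i = v.1 i) : u = v :=
  Subtype.ext (Equiv.ext h)

theorem transp_apply (i j k : ℕ) : (transp i j).1 k = Equiv.swap i j k := rfl

theorem simpleRefl_apply (i k : ℕ) : (simpleRefl i).1 k = Equiv.swap i (i + 1) k := rfl

@[simp] theorem simpleRefl_apply_left (i : ℕ) : (simpleRefl i).1 i = i + 1 :=
  Equiv.swap_apply_left _ _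

@[simp] theorem simpleRefl_apply_right (i : ℕ) : (simpleRefl i).1 (i + 1) = i :=
  Equiv.swap_apply_right _ _

theorem simpleRefl_apply_of_ne {i k : ℕ} (h1 : k ≠ i) (h2 : k ≠ i + 1) :
    (simpleRefl i).1 k = k :=
  Equiv.swap_apply_of_ne_of_ne h1 h2

@[simp] theorem transp_mul_self (i j : ℕ) : transp i j * transp i j = 1 :=
  Subtype.ext (Equiv.swap_mul_self i j)

@[simp] theorem transp_inv (i j : ℕ) : (transp i j)⁻¹ = transp i j :=
  inv_eq_of_mul_eq_one_left (transp_mul_self i j)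

@[simp] theorem simpleRefl_mul_self (i : ℕ) : simpleRefl i * simpleRefl i = 1 :=
  transp_mul_self i (i + 1)

@[simp] theorem simpleRefl_inv (i : ℕ) : (simpleRefl i)⁻¹ = simpleRefl i :=
  transp_inv i (i + 1)

@[simp] theorem simpleRefl_mul_cancel_left (i : ℕ) (w : SInf) :
    simpleRefl i * (simpleRefl i * w) = w := by
  rw [← mul_assoc, simpleRefl_mul_self, one_mul]

@[simp] theorem simpleRefl_mul_cancel_right (i : ℕ) (w : SInf) :
    w * simpleRefl i * simpleRefl i = w := by
  rw [mul_assoc, simpleRefl_mul_self, mul_one]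

@[simp] theorem transp_mul_cancel_right (i j : ℕ) (w : SInf) :
    w * transp i j * transp i j = w := by
  rw [mul_assoc, transp_mul_self, mul_one]

theorem inSn_one (n : ℕ) : InSn n 1 := fun _ _ => rfl

theorem InSn.mul {n : ℕ} {u v : SInf} (hu : InSn n u) (hv : InSn n v) : InSn n (u * v) :=
  fun i hi => by rw [SInf.mul_apply, hv i hi, hu i hi]

theorem InSn.inv {n : ℕ} {u : SInf} (hu : InSn n u) : InSn n u⁻¹ :=
  fun i hi => by conv_lhs => rw [← hu i hi]
                 exact SInf.inv_apply_self u i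

theorem InSn.mono {n m : ℕ} {u : SInf} (hu : InSn n u) (h : n ≤ m) : InSn m u :=
  fun i hi => hu i (h.trans hi)

theorem inSn_transp {n i j : ℕ} (hi : i < n) (hj : j < n) : InSn n (transp i j) :=
  fun _ hk => Equiv.swap_apply_of_ne_of_ne (by omega) (by omega)

theorem inSn_simpleRefl {n i : ℕ} (hi : i + 1 < n) : InSn n (simpleRefl i) :=
  inSn_transp (by omega) hi

theorem InSn.apply_lt {n : ℕ} {u : SInf} (hu : InSn n u) {i : ℕ} (hi : i < n) : u.1 i < n := by
  by_contra h
  have := u.1.injective (hu _ (not_lt.mp h))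
  omega

theorem longest_apply_of_lt {n i : ℕ} (h : i < n) : (longest n).1 i = n - 1 - i := if_pos h

theorem inSn_longest (n : ℕ) : InSn n (longest n) := fun _ hi => if_neg (not_lt.mpr hi)

@[simp] theorem longest_mul_self (n : ℕ) : longest n * longest n = 1 := by
  refine SInf.ext_apply fun i => ?_
  rw [SInf.mul_apply]
  by_cases h : i < n
  · rw [longest_apply_of_lt h, longest_apply_of_lt (by omega)]
    change _ = i
    omega
  · rw [inSn_longest n i (by omega), inSn_longest n i (by omega)]; rfl

@[simp] theorem longest_inv (n : ℕ) : (longest n)⁻¹ = longest n :=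
  inv_eq_of_mul_eq_one_left (longest_mul_self n)

@[simp] theorem longest_mul_cancel_left (n : ℕ) (w : SInf) :
    longest n * (longest n * w) = w := by
  rw [← mul_assoc, longest_mul_self, one_mul]

/-- The set of inversions. -/
def invSet (w : SInf) : Set (ℕ × ℕ) := {p | p.1 < p.2 ∧ w.1 p.2 < w.1 p.1}

theorem len_eq_ncard (w : SInf) : len w = (invSet w).ncard := rfl

theorem invSet_eq_filter {n : ℕ} {w : SInf} (hw : InSn n w) :
    invSet w = ((Finset.range n ×ˢ Finset.range n).filter
      fun p => p.1 < p.2 ∧ w.1 p.2 < w.1 p.1 : Finset (ℕ × ℕ)) := by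
  ext ⟨a, b⟩
  simp only [invSet, Set.mem_ofPred_eq, Finset.coe_filter, Finset.mem_product, Finset.mem_range]
  refine ⟨fun h => ⟨?_, h⟩, fun h => h.2⟩
  have hb : b < n := by
    by_contra hb
    rw [hw b (by omega)] at h
    by_cases ha : a < n
    · have := hw.apply_lt ha
      omega
    · rw [hw a (by omega)] at h
      omega
  exact ⟨h.1.trans hb, hb⟩

theorem lt_of_inversion {n : ℕ} {w : SInf} (hw : InSn n w) {a b : ℕ} (hab : a < b)
    (h : w.1 b < w.1 a) : b < n := by
  have : (a, b) ∈ invSet w := ⟨hab, h⟩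
  rw [invSet_eq_filter hw] at this
  simp at this
  exact this.1.2

theorem invSet_finite (w : SInf) : (invSet w).Finite := by
  obtain ⟨n, hn⟩ := w.2
  rw [invSet_eq_filter hn]
  exact Finset.finite_toSet _

theorem len_eq_sum_code {n : ℕ} {w : SInf} (hw : InSn n w) :
    len w = ∑ i ∈ Finset.range n, code n w i := by
  rw [len_eq_ncard, invSet_eq_filter hw, Set.ncard_coe_finset, Finset.card_filter,
    Finset.sum_product]
  refine Finset.sum_congr rfl fun i _ => ?_
  rw [code, Finset.card_filter]

/-- Left multiplication by `w_∘` reverses the order of the values. -/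
theorem code_longest_mul_eq {n : ℕ} {w : SInf} (hw : InSn n w) (i : ℕ) (hi : i < n) :
    code n (longest n * w) i
      = ((Finset.range n).filter fun j => i < j ∧ w.1 i < w.1 j).card := by
  unfold code
  congr 1
  refine Finset.filter_congr fun j hj => ?_
  have h1 := hw.apply_lt hi
  have h2 := hw.apply_lt (Finset.mem_range.mp hj)
  rw [SInf.mul_apply, SInf.mul_apply, longest_apply_of_lt h1, longest_apply_of_lt h2]
  omega

theorem code_add_code {n : ℕ} {w : SInf} (hw : InSn n w) (i : ℕ) (hi : i < n) :
    code n (longest n * w) i + code n w i = rho n i := by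
  rw [code_longest_mul_eq hw i hi, code, ← Finset.card_union_of_disjoint, ← Finset.filter_or]
  · have : (Finset.range n).filter (fun j => i < j ∧ w.1 i < w.1 j ∨ i < j ∧ w.1 j < w.1 i)
        = Finset.Ioo i n := by
      ext j
      simp only [Finset.mem_filter, Finset.mem_range, Finset.mem_Ioo]
      have := fun h : w.1 i = w.1 j => w.1.injective h
      constructor
      · rintro ⟨h, h' | h'⟩ <;> exact ⟨h'.1, h⟩
      · intro h
        have hne : w.1 i ≠ w.1 j := fun h' => by have := this h'; omega
        omega
    rw [this, Nat.card_Ioo, rho]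
    omega
  · rw [Finset.disjoint_filter]
    intro j _ h1 h2
    omega

theorem len_longest_mul_add {n : ℕ} {w : SInf} (hw : InSn n w) :
    len (longest n * w) + len w = ∑ i ∈ Finset.range n, rho n i := by
  rw [len_eq_sum_code hw, len_eq_sum_code ((inSn_longest n).mul hw), ← Finset.sum_add_distrib]
  exact Finset.sum_congr rfl fun i hi => code_add_code hw i (Finset.mem_range.mp hi)

theorem len_one : len 1 = 0 := by
  rw [len_eq_ncard, Set.ncard_eq_zero (invSet_finite 1)]
  ext ⟨a, b⟩
  simp only [invSet, Set.mem_ofPred_eq, Set.mem_empty_iff_false, iff_false]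
  rintro ⟨h1, h2⟩
  exact absurd h1 (not_lt.mpr (le_of_lt h2))

theorem len_inv (w : SInf) : len w⁻¹ = len w := by
  rw [len_eq_ncard, len_eq_ncard]
  refine Set.ncard_congr (fun p _ => ((w⁻¹).1 p.2, (w⁻¹).1 p.1)) ?_ ?_ ?_
  · rintro ⟨a, b⟩ ⟨h1, h2⟩
    refine ⟨h2, ?_⟩
    simpa only [SInf.apply_inv_self] using h1
  · rintro ⟨a, b⟩ ⟨c, d⟩ _ _ h
    simp only [Prod.mk.injEq, (w⁻¹).1.injective.eq_iff] at h
    rw [h.1, h.2]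
  · rintro ⟨a, b⟩ ⟨h1, h2⟩
    refine ⟨(w.1 b, w.1 a), ⟨h2, ?_⟩, ?_⟩
    · simpa only [SInf.inv_apply_self] using h1
    · simp only [SInf.inv_apply_self]

/-- The map that sends inversions of `w` to inversions of `w * transp a b`
when `w a < w b`. -/
def invMap (a b : ℕ) (p : ℕ × ℕ) : ℕ × ℕ :=
  if Equiv.swap a b p.1 < Equiv.swap a b p.2 then (Equiv.swap a b p.1, Equiv.swap a b p.2) else p

theorem invMap_injOn (a b : ℕ) (s : Set (ℕ × ℕ)) (hs : ∀ p ∈ s, p.1 < p.2) :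
    Set.InjOn (invMap a b) s := by
  rintro ⟨p, q⟩ hp ⟨r, t⟩ hr h
  have hp' := hs _ hp
  have hr' := hs _ hr
  simp only [invMap] at h
  split_ifs at h with h1 h2 h2
  · simp only [Prod.mk.injEq, EmbeddingLike.apply_eq_iff_eq] at h
    rw [h.1, h.2]
  · simp only [Prod.mk.injEq] at h
    rw [← h.1, ← h.2, Equiv.swap_apply_self, Equiv.swap_apply_self] at h2
    exact absurd hp' h2
  · simp only [Prod.mk.injEq] at h
    rw [h.1, h.2, Equiv.swap_apply_self, Equiv.swap_apply_self] at h1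
    exact absurd hr' h1
  · exact h

/-- If the swap keeps the order of a pair, the moved pair has the same values in `w * transp a b`.
If it reverses the order, one entry is `a` or `b` and the other lies strictly between; then `w a < w
b` only widens the inversion, which stays where it is. -/
theorem invMap_mem {w : SInf} {a b : ℕ} (hab : a < b) (h : w.1 a < w.1 b) {p : ℕ × ℕ}
    (hp : p ∈ invSet w) : invMap a b p ∈ invSet (w * transp a b) \ {(a, b)} := by
  obtain ⟨p, q⟩ := p
  obtain ⟨h1, h2⟩ := hp
  simp only at h1 h2
  simp only [invMap]
  split_ifs with h3
  · refine ⟨⟨h3, ?_⟩, ?_⟩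
    · simpa only [SInf.mul_apply, transp_apply, Equiv.swap_apply_self] using h2
    · rintro h4
      rw [Set.mem_singleton_iff, Prod.mk.injEq, Equiv.swap_apply_eq_iff,
        Equiv.swap_apply_eq_iff, Equiv.swap_apply_left, Equiv.swap_apply_right] at h4
      omega
  · refine ⟨⟨h1, ?_⟩, ?_⟩
    · simp only [SInf.mul_apply, transp_apply]
      have hne : p ≠ a ∨ q ≠ b := by
        by_contra! h4
        rw [h4.1, h4.2] at h2
        omega
      simp only [Equiv.swap_apply_def] at h3 ⊢
      split_ifs at h3 ⊢ <;> first | omega | (subst_vars; omega)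
    · rintro h4
      rw [Set.mem_singleton_iff, Prod.mk.injEq] at h4
      rw [h4.1, h4.2] at h2
      omega

theorem len_lt_len_mul_transp {w : SInf} {a b : ℕ} (hab : a < b) (h : w.1 a < w.1 b) :
    len w < len (w * transp a b) := by
  have hmem : (a, b) ∈ invSet (w * transp a b) := by
    refine ⟨hab, ?_⟩
    simpa only [SInf.mul_apply, transp_apply, Equiv.swap_apply_left, Equiv.swap_apply_right]
      using h
  have hfin := invSet_finite (w * transp a b)
  have h1 : len w ≤ (invSet (w * transp a b) \ {(a, b)}).ncard :=
    Set.ncard_le_ncard_of_injOn (invMap a b) (fun p hp => invMap_mem hab h hp)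
      (invMap_injOn a b _ fun p hp => hp.1) hfin.sdiff
  have h2 := Set.ncard_sdiff_singleton_add_one hmem hfin
  rw [len_eq_ncard (w * transp a b)]
  omega

theorem len_mul_transp_lt {w : SInf} {a b : ℕ} (hab : a < b) (h : w.1 b < w.1 a) :
    len (w * transp a b) < len w := by
  have := len_lt_len_mul_transp (w := w * transp a b) hab (by
    simpa only [SInf.mul_apply, transp_apply, Equiv.swap_apply_left, Equiv.swap_apply_right]
      using h)
  rwa [transp_mul_cancel_right] at this

theorem len_mul_simpleRefl_of_lt {w : SInf} {i : ℕ} (h : w.1 i < w.1 (i + 1)) :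
    len (w * simpleRefl i) = len w + 1 := by
  have h1 := len_lt_len_mul_transp (Nat.lt_succ_self i) h
  have hfin := invSet_finite (w * simpleRefl i)
  have h2 : (invSet (w * simpleRefl i) \ {(i, i + 1)}).ncard ≤ len w := by
    refine Set.ncard_le_ncard_of_injOn (invMap i (i + 1)) ?_
      (invMap_injOn i (i + 1) _ fun p hp => hp.1.1) (invSet_finite w)
    rintro ⟨p, q⟩ ⟨⟨hp1, hp2⟩, hp3⟩
    simp only [Set.mem_singleton_iff, Prod.mk.injEq] at hp3
    simp only at hp1
    -- An adjacent swap reverses no pair of positions except `(i, i + 1)`, so `invMap` also injects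
    -- backwards and the length grows by exactly one.
    have h3 : Equiv.swap i (i + 1) p < Equiv.swap i (i + 1) q := by
      simp only [Equiv.swap_apply_def]
      split_ifs <;> omega
    simp only [invMap, if_pos h3]
    exact ⟨h3, hp2⟩
  have h3 := Set.ncard_le_ncard_sdiff_add_ncard (invSet (w * simpleRefl i)) {(i, i + 1)}
  rw [Set.ncard_singleton, ← len_eq_ncard] at h3
  change len w < len (w * simpleRefl i) at h1
  omega

theorem len_mul_simpleRefl_of_gt {w : SInf} {i : ℕ} (h : w.1 (i + 1) < w.1 i) :
    len (w * simpleRefl i) + 1 = len w := by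
  have := len_mul_simpleRefl_of_lt (w := w * simpleRefl i) (i := i) (by
    simpa only [SInf.mul_apply, simpleRefl_apply_left, simpleRefl_apply_right] using h)
  rw [simpleRefl_mul_cancel_right] at this
  exact this.symm

theorem len_simpleRefl_mul_eq (w : SInf) (i : ℕ) :
    len (simpleRefl i * w) = len (w⁻¹ * simpleRefl i) := by
  rw [← len_inv, mul_inv_rev, simpleRefl_inv]

theorem len_simpleRefl_mul_of_lt {w : SInf} {i : ℕ} (h : (w⁻¹).1 i < (w⁻¹).1 (i + 1)) :
    len (simpleRefl i * w) = len w + 1 := by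
  rw [len_simpleRefl_mul_eq, len_mul_simpleRefl_of_lt h, len_inv]

theorem len_simpleRefl_mul_of_gt {w : SInf} {i : ℕ} (h : (w⁻¹).1 (i + 1) < (w⁻¹).1 i) :
    len (simpleRefl i * w) + 1 = len w := by
  rw [len_simpleRefl_mul_eq, len_mul_simpleRefl_of_gt h, len_inv]

theorem lt_or_gt_succ (w : SInf) (i : ℕ) : w.1 i < w.1 (i + 1) ∨ w.1 (i + 1) < w.1 i :=
  lt_or_gt_of_ne fun h => Nat.succ_ne_self i (w.1.injective h).symm

theorem eq_one_of_forall_lt {w : SInf} (h : ∀ i, w.1 i < w.1 (i + 1)) : w = 1 := by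
  have hmono : StrictMono w.1 := strictMono_nat_of_lt_succ h
  obtain ⟨n, hn⟩ := w.2
  refine SInf.ext_apply fun i => le_antisymm ?_ (hmono.le_apply)
  change w.1 i ≤ i
  have key : ∀ d, w.1 i + d ≤ w.1 (i + d) := by
    intro d
    induction d with
    | zero => rfl
    | succ d ih => have := h (i + d); rw [← add_assoc, ← add_assoc]; omega
  have h1 := key n
  rw [hn (i + n) (by omega)] at h1
  omega

theorem exists_descent {w : SInf} (h : w ≠ 1) : ∃ i, w.1 (i + 1) < w.1 i := by
  by_contra! h'
  exact h (eq_one_of_forall_lt fun i => (lt_or_gt_succ w i).resolve_right (not_lt.mpr (h' i)))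

theorem eq_one_of_len_eq_zero {w : SInf} (h : len w = 0) : w = 1 := by
  by_contra h'
  obtain ⟨i, hi⟩ := exists_descent h'
  have := len_mul_simpleRefl_of_gt hi
  omega

theorem eq_longest_of_len_eq {n : ℕ} {w : SInf} (hw : InSn n w)
    (h : len w = ∑ i ∈ Finset.range n, rho n i) : w = longest n := by
  have h1 := len_longest_mul_add hw
  have h2 : longest n * w = 1 := eq_one_of_len_eq_zero (by omega)
  rw [← longest_mul_cancel_left n w, h2, mul_one]

/-- Induction on right descents in `S_n`. -/
theorem InSn.descent_induction {n : ℕ} {P : SInf → Prop} (one : P 1)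
    (step : ∀ w i, i + 1 < n → InSn n w → w.1 i < w.1 (i + 1) → P w → P (w * simpleRefl i))
    {w : SInf} (hw : InSn n w) : P w := by
  induction h : len w generalizing w with
  | zero => rw [eq_one_of_len_eq_zero h]; exact one
  | succ l ih =>
    have hne : w ≠ 1 := by rintro rfl; rw [len_one] at h; omega
    obtain ⟨i, hi⟩ := exists_descent hne
    have hin := lt_of_inversion hw (Nat.lt_succ_self i) hi
    have h1 := len_mul_simpleRefl_of_gt hi
    have hw' : InSn n (w * simpleRefl i) := hw.mul (inSn_simpleRefl hin)
    have := step (w * simpleRefl i) i hin hw' (by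
      simpa only [SInf.mul_apply, simpleRefl_apply_left, simpleRefl_apply_right] using hi)
      (ih hw' (by omega))
    rwa [simpleRefl_mul_cancel_right] at this

/-! ### Reduced words and the operators `A_w` -/

theorem simpleRefl_comm {i j : ℕ} (h : i + 2 ≤ j) :
    simpleRefl i * simpleRefl j = simpleRefl j * simpleRefl i := by
  refine SInf.ext_apply fun k => ?_
  simp only [SInf.mul_apply, simpleRefl_apply, Equiv.swap_apply_def]
  split_ifs <;> omega

theorem simpleRefl_braid (i : ℕ) :
    simpleRefl i * (simpleRefl (i + 1) * simpleRefl i)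
      = simpleRefl (i + 1) * (simpleRefl i * simpleRefl (i + 1)) := by
  refine SInf.ext_apply fun k => ?_
  simp only [SInf.mul_apply, simpleRefl_apply, Equiv.swap_apply_def]
  split_ifs <;> omega

theorem len_simpleRefl_mul_le (w : SInf) (i : ℕ) : len (simpleRefl i * w) ≤ len w + 1 := by
  rcases lt_or_gt_succ w⁻¹ i with h | h
  · exact (len_simpleRefl_mul_of_lt h).le
  · have := len_simpleRefl_mul_of_gt h
    omega

theorem len_le_len_simpleRefl_mul (w : SInf) (i : ℕ) : len w ≤ len (simpleRefl i * w) + 1 := by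
  have := len_simpleRefl_mul_le (simpleRefl i * w) i
  rwa [simpleRefl_mul_cancel_left] at this

theorem len_word_mul_le (l : List ℕ) (v : SInf) :
    len ((l.map simpleRefl).prod * v) ≤ l.length + len v := by
  induction l with
  | nil => simp
  | cons i l ih =>
    rw [List.map_cons, List.prod_cons, List.length_cons, mul_assoc]
    have := len_simpleRefl_mul_le ((l.map simpleRefl).prod * v) i
    omega

theorem len_word_le (l : List ℕ) : len (l.map simpleRefl).prod ≤ l.length := by
  simpa only [mul_one, len_one, add_zero] using len_word_mul_le l 1

theorem exists_word_length_eq_len (w : SInf) :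
    ∃ l : List ℕ, (l.map simpleRefl).prod = w ∧ l.length = len w := by
  obtain ⟨n, hn⟩ := w.2
  refine InSn.descent_induction (n := n)
    (P := fun w => ∃ l : List ℕ, (l.map simpleRefl).prod = w ∧ l.length = len w)
    ⟨[], rfl, len_one.symm⟩ ?_ hn
  rintro w i _ _ hi ⟨l, hl, hlen⟩
  refine ⟨l ++ [i], ?_, ?_⟩
  · simp [hl]
  · rw [len_mul_simpleRefl_of_lt hi, ← hlen, List.length_append, List.length_singleton]

/-- One letter changes the length by at most one, and sorting along descents attains the bound. -/
theorem isReducedWord_iff {w : SInf} {l : List ℕ} :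
    IsReducedWord w l ↔ (l.map simpleRefl).prod = w ∧ l.length = len w := by
  constructor
  · rintro ⟨h1, h2⟩
    obtain ⟨m, hm, hlen⟩ := exists_word_length_eq_len w
    refine ⟨h1, le_antisymm (hlen ▸ h2 m hm) ?_⟩
    rw [← h1]
    exact len_word_le l
  · rintro ⟨h1, h2⟩
    refine ⟨h1, fun m hm => ?_⟩
    rw [h2, ← hm]
    exact len_word_le m

theorem len_mul_le (u v : SInf) : len (u * v) ≤ len u + len v := by
  obtain ⟨l, rfl, hlen⟩ := exists_word_length_eq_len u
  rw [← hlen]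
  exact len_word_mul_le l v

theorem IsReducedWord.of_cons {w : SInf} {i : ℕ} {l : List ℕ} (h : IsReducedWord w (i :: l)) :
    IsReducedWord (simpleRefl i * w) l ∧ (w⁻¹).1 (i + 1) < (w⁻¹).1 i := by
  rw [isReducedWord_iff, List.map_cons, List.prod_cons, List.length_cons] at h
  have hprod : (l.map simpleRefl).prod = simpleRefl i * w := by
    rw [← h.1, simpleRefl_mul_cancel_left]
  have h1 := len_le_len_simpleRefl_mul w i
  have h2 := len_word_le l
  rw [hprod] at h2
  refine ⟨isReducedWord_iff.mpr ⟨hprod, by omega⟩, ?_⟩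
  refine (lt_or_gt_succ w⁻¹ i).resolve_left fun h3 => ?_
  have := len_simpleRefl_mul_of_lt h3
  omega

theorem IsReducedWord.cons {w : SInf} {i : ℕ} {l : List ℕ}
    (h : IsReducedWord (simpleRefl i * w) l) (hi : (w⁻¹).1 (i + 1) < (w⁻¹).1 i) :
    IsReducedWord w (i :: l) := by
  rw [isReducedWord_iff] at h ⊢
  refine ⟨?_, ?_⟩
  · rw [List.map_cons, List.prod_cons, h.1, simpleRefl_mul_cancel_left]
  · rw [List.length_cons, h.2, len_simpleRefl_mul_of_gt hi]

/-- Inductive step of the Matsumoto–Tits argument. Both `i` and `j` are left descents of `w`, so `w`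
has reduced words starting with either side of the commutation or braid relation for `i, j` and
sharing a tail `k`. The induction hypothesis compares the given tails with these words, and the
relation for divided differences joins them. -/
theorem foldr_divDiff_eq_of_lt {d : ℕ}
    (ih : ∀ (w : SInf) (l m : List ℕ), l.length ≤ d → IsReducedWord w l → IsReducedWord w m →
      ∀ f, l.foldr divDiff f = m.foldr divDiff f)
    {w : SInf} {i j : ℕ} {l m : List ℕ} (hij : i < j) (hd : l.length ≤ d)
    (hl : IsReducedWord w (i :: l)) (hm : IsReducedWord w (j :: m)) (f : MvPolynomial ℕ ℚ) :
    (i :: l).foldr divDiff f = (j :: m).foldr divDiff f := by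
  obtain ⟨hl', hi⟩ := hl.of_cons
  obtain ⟨hm', hj⟩ := hm.of_cons
  have hd' : m.length ≤ d := by
    have h1 := (isReducedWord_iff.mp hl).2
    have h2 := (isReducedWord_iff.mp hm).2
    simp only [List.length_cons] at h1 h2
    omega
  rw [List.foldr_cons, List.foldr_cons]
  rcases Nat.lt_or_ge (i + 1) j with h | h
  · obtain ⟨k, hk⟩ := exists_reducedWord (simpleRefl j * (simpleRefl i * w))
    have hk1 : IsReducedWord (simpleRefl i * w) (j :: k) := hk.cons (by
      rw [mul_inv_rev, simpleRefl_inv, SInf.mul_apply, SInf.mul_apply,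
        simpleRefl_apply_of_ne (by omega) (by omega), simpleRefl_apply_of_ne (by omega) (by omega)]
      exact hj)
    have hk2 : IsReducedWord (simpleRefl j * w) (i :: k) := by
      refine IsReducedWord.cons ?_ ?_
      · rwa [← mul_assoc, simpleRefl_comm h, mul_assoc]
      · rw [mul_inv_rev, simpleRefl_inv, SInf.mul_apply, SInf.mul_apply,
          simpleRefl_apply_of_ne (by omega) (by omega),
          simpleRefl_apply_of_ne (by omega) (by omega)]
        exact hi
    rw [ih _ l (j :: k) hd hl' hk1, ih _ m (i :: k) hd' hm' hk2, List.foldr_cons,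
      List.foldr_cons, divDiff_comm h]
  · obtain rfl : j = i + 1 := by omega
    obtain ⟨k, hk⟩ := exists_reducedWord (simpleRefl i * (simpleRefl (i + 1) * (simpleRefl i * w)))
    have e1 : (simpleRefl i).1 (i + 1 + 1) = i + 2 :=
      simpleRefl_apply_of_ne (by omega) (by omega)
    have e2 : (simpleRefl (i + 1)).1 i = i := simpleRefl_apply_of_ne (by omega) (by omega)
    have hk1 : IsReducedWord (simpleRefl i * w) ((i + 1) :: i :: k) := by
      refine (hk.cons ?_).cons ?_
      · simp only [mul_inv_rev, simpleRefl_inv, SInf.mul_apply, simpleRefl_apply_left, e1, e2]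
        exact hj
      · simp only [mul_inv_rev, simpleRefl_inv, SInf.mul_apply, simpleRefl_apply_right, e1]
        exact hj.trans hi
    have hk2 : IsReducedWord (simpleRefl (i + 1) * w) (i :: (i + 1) :: k) := by
      refine IsReducedWord.cons (IsReducedWord.cons ?_ ?_) ?_
      · rw [← mul_assoc, ← mul_assoc, mul_assoc (simpleRefl (i + 1)), ← simpleRefl_braid]
        simpa only [mul_assoc] using hk
      · simp only [mul_inv_rev, simpleRefl_inv, SInf.mul_apply, simpleRefl_apply_right,
          e1, e2]
        exact hi
      · simp only [mul_inv_rev, simpleRefl_inv, SInf.mul_apply, simpleRefl_apply_left, e2]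
        exact hj.trans hi
    rw [ih _ l _ hd hl' hk1, ih _ m _ hd' hm' hk2]
    exact divDiff_braid i _

/-- The operators attached to two reduced words of the same permutation are equal. -/
theorem foldr_divDiff_eq {w : SInf} {l m : List ℕ} (hl : IsReducedWord w l)
    (hm : IsReducedWord w m) (f : MvPolynomial ℕ ℚ) :
    l.foldr divDiff f = m.foldr divDiff f := by
  obtain ⟨d, hd⟩ : ∃ d, l.length ≤ d := ⟨_, le_rfl⟩
  induction d generalizing w l m f with
  | zero =>
    have h1 := (isReducedWord_iff.mp hl).2
    have h2 := (isReducedWord_iff.mp hm).2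
    rw [List.eq_nil_of_length_eq_zero (l := l) (by omega),
      List.eq_nil_of_length_eq_zero (l := m) (by omega)]
  | succ d ih =>
    have hlen : l.length = m.length :=
      (isReducedWord_iff.mp hl).2.trans (isReducedWord_iff.mp hm).2.symm
    match l, m, hlen with
    | [], [], _ => rfl
    | i :: l, j :: m, hlen =>
      simp only [List.length_cons] at hd hlen
      have ih' : ∀ (w : SInf) (l m : List ℕ), l.length ≤ d → IsReducedWord w l →
          IsReducedWord w m → ∀ f, l.foldr divDiff f = m.foldr divDiff f :=
        fun w l m hd hl hm f => ih hl hm f hd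
      rcases lt_trichotomy i j with h | rfl | h
      · exact foldr_divDiff_eq_of_lt ih' h (by omega) hl hm f
      · rw [List.foldr_cons, List.foldr_cons,
          ih hl.of_cons.1 hm.of_cons.1 f (by omega)]
      · exact (foldr_divDiff_eq_of_lt ih' h (by omega) hm hl f).symm

/-! ### The operators `A_w` and their nil-Coxeter relations -/

theorem divDiffPerm_eq {w : SInf} {l : List ℕ} (h : IsReducedWord w l) (f : MvPolynomial ℕ ℚ) :
    divDiffPerm w f = l.foldr divDiff f :=
  foldr_divDiff_eq (exists_reducedWord w).choose_spec h f

@[simp] theorem divDiffPerm_one (f : MvPolynomial ℕ ℚ) : divDiffPerm 1 f = f :=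
  divDiffPerm_eq (l := []) (isReducedWord_iff.mpr ⟨rfl, len_one.symm⟩) f

theorem foldr_divDiff_add (l : List ℕ) (f g : MvPolynomial ℕ ℚ) :
    l.foldr divDiff (f + g) = l.foldr divDiff f + l.foldr divDiff g := by
  induction l with
  | nil => rfl
  | cons i l ih => rw [List.foldr_cons, ih, divDiff_add]; rfl

theorem foldr_divDiff_C_mul (l : List ℕ) (c : ℚ) (f : MvPolynomial ℕ ℚ) :
    l.foldr divDiff (C c * f) = C c * l.foldr divDiff f := by
  induction l with
  | nil => rfl
  | cons i l ih => rw [List.foldr_cons, ih, divDiff_C_mul]; rfl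

/-- `A_w` as a linear map. -/
noncomputable def divDiffLin (w : SInf) : MvPolynomial ℕ ℚ →ₗ[ℚ] MvPolynomial ℕ ℚ where
  toFun := divDiffPerm w
  map_add' f g := foldr_divDiff_add _ f g
  map_smul' c f := by
    simp only [smul_eq_C_mul, RingHom.id_apply]
    exact foldr_divDiff_C_mul _ c f

theorem divDiff_divDiffPerm_of_lt {w : SInf} {i : ℕ} (h : (w⁻¹).1 i < (w⁻¹).1 (i + 1))
    (f : MvPolynomial ℕ ℚ) :
    divDiff i (divDiffPerm w f) = divDiffPerm (simpleRefl i * w) f := by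
  obtain ⟨l, hl⟩ := exists_reducedWord w
  have hl' : IsReducedWord (simpleRefl i * w) (i :: l) := by
    rw [isReducedWord_iff] at hl ⊢
    rw [List.map_cons, List.prod_cons, List.length_cons, hl.1, hl.2, len_simpleRefl_mul_of_lt h]
    exact ⟨rfl, rfl⟩
  rw [divDiffPerm_eq hl, divDiffPerm_eq hl', List.foldr_cons]

/-- Here `A_w = A_i A_{s_i w}`, and `A_i A_i = 0`. -/
theorem divDiff_divDiffPerm_of_gt {w : SInf} {i : ℕ} (h : (w⁻¹).1 (i + 1) < (w⁻¹).1 i)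
    (f : MvPolynomial ℕ ℚ) : divDiff i (divDiffPerm w f) = 0 := by
  have := divDiff_divDiffPerm_of_lt (w := simpleRefl i * w) (i := i) (f := f) (by
    simpa only [mul_inv_rev, simpleRefl_inv, SInf.mul_apply, simpleRefl_apply_left,
      simpleRefl_apply_right] using h)
  rw [simpleRefl_mul_cancel_left] at this
  rw [← this, divDiff_divDiff]

theorem divDiffPerm_divDiff_of_lt {w : SInf} {i : ℕ} (h : w.1 i < w.1 (i + 1))
    (f : MvPolynomial ℕ ℚ) :
    divDiffPerm w (divDiff i f) = divDiffPerm (w * simpleRefl i) f := by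
  obtain ⟨l, hl⟩ := exists_reducedWord w
  have hl' : IsReducedWord (w * simpleRefl i) (l ++ [i]) := by
    rw [isReducedWord_iff] at hl ⊢
    rw [List.map_append, List.prod_append, List.length_append, hl.1, hl.2,
      len_mul_simpleRefl_of_lt h]
    simp
  rw [divDiffPerm_eq hl, divDiffPerm_eq hl', List.foldr_append]
  rfl

theorem divDiffPerm_zero (w : SInf) : divDiffPerm w 0 = 0 := (divDiffLin w).map_zero

theorem divDiffPerm_divDiff_of_gt {w : SInf} {i : ℕ} (h : w.1 (i + 1) < w.1 i)
    (f : MvPolynomial ℕ ℚ) : divDiffPerm w (divDiff i f) = 0 := by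
  have := divDiffPerm_divDiff_of_lt (w := w * simpleRefl i) (i := i) (f := divDiff i f) (by
    simpa only [SInf.mul_apply, simpleRefl_apply_left, simpleRefl_apply_right] using h)
  rw [simpleRefl_mul_cancel_right] at this
  rw [← this, divDiff_divDiff, divDiffPerm_zero]

theorem divDiffPerm_divDiffPerm (u v : SInf) (f : MvPolynomial ℕ ℚ) :
    divDiffPerm u (divDiffPerm v f)
      = if len (u * v) = len u + len v then divDiffPerm (u * v) f else 0 := by
  obtain ⟨n, hn⟩ := u.2
  refine InSn.descent_induction (n := n) (P := fun u => ∀ v, divDiffPerm u (divDiffPerm v f)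
      = if len (u * v) = len u + len v then divDiffPerm (u * v) f else 0) ?_ ?_ hn v
  · intro v
    simp [len_one]
  · intro u i _ _ hi ih v
    rw [← divDiffPerm_divDiff_of_lt hi, len_mul_simpleRefl_of_lt hi, mul_assoc]
    rcases lt_or_gt_succ v⁻¹ i with h | h
    · rw [divDiff_divDiffPerm_of_lt h, ih, len_simpleRefl_mul_of_lt h]
      simp only [add_assoc, add_comm 1]
    -- Since `s_i` shortens `v`, the length of the product is too small to be additive.
    · rw [divDiff_divDiffPerm_of_gt h, divDiffPerm_zero, if_neg]
      have h1 := len_simpleRefl_mul_of_gt h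
      have h2 := len_mul_le u (simpleRefl i * v)
      omega

/-! ### The Chevalley-Monk rule for divided differences -/

theorem InSn.left_descent_induction {n : ℕ} {P : SInf → Prop} (one : P 1)
    (step : ∀ w i, i + 1 < n → InSn n w → (w⁻¹).1 i < (w⁻¹).1 (i + 1) → P w →
      P (simpleRefl i * w))
    {w : SInf} (hw : InSn n w) : P w := by
  rw [← inv_inv w]
  refine InSn.descent_induction (n := n) (P := fun w => P w⁻¹) (by rwa [inv_one]) ?_ hw.inv
  intro w i hi hw h hP
  rw [mul_inv_rev, simpleRefl_inv]
  exact step _ i hi hw.inv (by rwa [inv_inv]) hP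

/-- The pairs `(a, b)` with `a < b < n`. -/
def pairs (n : ℕ) : Finset (ℕ × ℕ) :=
  (Finset.range n ×ˢ Finset.range n).filter fun p => p.1 < p.2

theorem mem_pairs {n : ℕ} {p : ℕ × ℕ} : p ∈ pairs n ↔ p.1 < p.2 ∧ p.2 < n := by
  simp only [pairs, Finset.mem_filter, Finset.mem_product, Finset.mem_range]
  omega

/-- Induction on left descents: apply `A_i` to the formula for `v`. The Leibniz correction from `X
(v j)` supplies the new cover, and every other pair contributes equally before and after. -/
theorem divDiffPerm_mul_X {n : ℕ} {w : SInf} (hw : InSn n w) (j : ℕ) (f : MvPolynomial ℕ ℚ) :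
    divDiffPerm w (f * X j) = divDiffPerm w f * X (w.1 j)
      + ∑ p ∈ pairs n, if len (w * transp p.1 p.2) + 1 = len w then
          C ((if j = p.1 then 1 else 0) - (if j = p.2 then 1 else 0))
            * divDiffPerm (w * transp p.1 p.2) f else 0 := by
  refine InSn.left_descent_induction (n := n) (P := fun w => divDiffPerm w (f * X j)
    = divDiffPerm w f * X (w.1 j)
      + ∑ p ∈ pairs n, if len (w * transp p.1 p.2) + 1 = len w then
          C ((if j = p.1 then 1 else 0) - (if j = p.2 then 1 else 0))
            * divDiffPerm (w * transp p.1 p.2) f else 0) ?_ ?_ hw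
  · simp [len_one]
  · intro v i hin hv hi ih
    have hsum : ∀ (s : Finset (ℕ × ℕ)) (g : ℕ × ℕ → MvPolynomial ℕ ℚ),
        divDiff i (∑ p ∈ s, g p) = ∑ p ∈ s, divDiff i (g p) := by
      intro s g
      induction s using Finset.cons_induction with
      | empty => simp
      | cons a s ha ih => rw [Finset.sum_cons, Finset.sum_cons, divDiff_add, ih]
    set a := (v⁻¹).1 i with ha
    set b := (v⁻¹).1 (i + 1) with hb
    have hva : v.1 a = i := SInf.apply_inv_self v i
    have hvb : v.1 b = i + 1 := SInf.apply_inv_self v (i + 1)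
    have hab : (a, b) ∈ pairs n := mem_pairs.mpr ⟨hi, hv.inv.apply_lt hin⟩
    have hja : (v.1 j = i) ↔ j = a := by rw [← hva]; exact v.1.injective.eq_iff
    have hjb : (v.1 j = i + 1) ↔ j = b := by rw [← hvb]; exact v.1.injective.eq_iff
    -- The positions `a, b` of the values `i, i + 1` form the one pair whose transposition undoes
    -- `s_i`; it yields the Leibniz correction term.
    have ht : simpleRefl i * v * transp a b = v := by
      refine SInf.ext_apply fun k => ?_
      simp only [SInf.mul_apply, transp_apply]
      rcases eq_or_ne k a with rfl | h1
      · rw [Equiv.swap_apply_left, hvb, simpleRefl_apply_right, hva]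
      · rcases eq_or_ne k b with rfl | h2
        · rw [Equiv.swap_apply_right, hva, simpleRefl_apply_left, hvb]
        · rw [Equiv.swap_apply_of_ne_of_ne h1 h2, simpleRefl_apply_of_ne]
          · rw [← hva]; exact fun h => h1 (v.1.injective h)
          · rw [← hvb]; exact fun h => h2 (v.1.injective h)
    rw [← divDiff_divDiffPerm_of_lt hi, ih, divDiff_add, divDiff_mul_X, hsum,
      ← divDiff_divDiffPerm_of_lt hi, len_simpleRefl_mul_of_lt hi,
      ← Finset.add_sum_erase _ _ hab, ← Finset.add_sum_erase _ _ hab]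
    have hlen := len_lt_len_mul_transp (w := v) hi (by rw [hva, hvb]; omega)
    simp only [ht, if_true, hja, hjb]
    rw [if_neg (show ¬ len (v * transp a b) + 1 = len v by omega), divDiff_zero, zero_add,
      SInf.mul_apply, simpleRefl_apply, add_assoc]
    congr 2
    refine Finset.sum_congr rfl fun p hp => ?_
    obtain ⟨hne, hp⟩ := Finset.mem_erase.mp hp
    obtain ⟨c, d⟩ := p
    obtain ⟨hcd, -⟩ := mem_pairs.mp hp
    simp only at hcd ⊢
    rw [mul_assoc]
    rcases lt_or_gt_succ (v * transp c d)⁻¹ i with h | h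
    · rw [len_simpleRefl_mul_of_lt h, ← divDiff_divDiffPerm_of_lt h]
      simp only [Nat.add_right_cancel_iff]
      split_ifs <;> simp
    · have h1 := len_simpleRefl_mul_of_gt h
      -- Otherwise `v * transp c d` would be one longer than `v`, so `v c < v d`. As `(c, d) ≠ (a,
      -- b)`, `s_i` preserves this inequality, which makes `s_i v * transp c d` longer than `s_i v`,
      -- a contradiction.
      have hneg : ¬ len (simpleRefl i * (v * transp c d)) + 1 = len v + 1 := by
        intro h2
        have h3 : v.1 c < v.1 d := by
          by_contra h3
          have hne' : v.1 c ≠ v.1 d := fun h' => hcd.ne (v.1.injective h')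
          have := len_mul_transp_lt (w := v) hcd (by omega)
          omega
        have h4 : (simpleRefl i * v).1 c < (simpleRefl i * v).1 d := by
          have hne' : ¬ (v.1 c = i ∧ v.1 d = i + 1) := by
            rintro ⟨h5, h6⟩
            apply hne
            rw [Prod.mk.injEq]
            exact ⟨v.1.injective (h5.trans hva.symm), v.1.injective (h6.trans hvb.symm)⟩
          simp only [SInf.mul_apply, simpleRefl_apply, Equiv.swap_apply_def]
          split_ifs <;> omega
        have h5 := len_lt_len_mul_transp hcd h4
        rw [mul_assoc, len_simpleRefl_mul_of_lt hi] at h5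
        omega
      rw [if_neg hneg]
      split_ifs
      iterate 4 rw [divDiff_C_mul, divDiff_divDiffPerm_of_gt h, mul_zero]
      rw [divDiff_zero]

/-- The functional `f ↦` constant term of `A_w f`. -/
noncomputable def ctLin (w : SInf) : MvPolynomial ℕ ℚ →ₗ[ℚ] ℚ :=
  (lcoeff ℚ 0).comp (divDiffLin w)

theorem ctLin_apply (w : SInf) (f : MvPolynomial ℕ ℚ) :
    ctLin w f = constantCoeff (divDiffPerm w f) := rfl

theorem ctLin_mul_X {n : ℕ} {w : SInf} (hw : InSn n w) (j : ℕ) (f : MvPolynomial ℕ ℚ) :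
    ctLin w (f * X j) = ∑ p ∈ pairs n, if len (w * transp p.1 p.2) + 1 = len w then
          ((if j = p.1 then 1 else 0) - (if j = p.2 then 1 else 0))
            * ctLin (w * transp p.1 p.2) f else 0 := by
  rw [ctLin_apply, divDiffPerm_mul_X hw, map_add, map_mul, constantCoeff_X, mul_zero, zero_add,
    map_sum]
  refine Finset.sum_congr rfl fun p _ => ?_
  split_ifs <;> simp [ctLin_apply]

theorem divDiffPerm_C {w : SInf} (hw : w ≠ 1) (c : ℚ) : divDiffPerm w (C c) = 0 := by
  obtain ⟨i, hi⟩ := exists_descent hw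
  have := divDiffPerm_divDiff_of_lt (w := w * simpleRefl i) (i := i) (f := C c) (by
    simpa only [SInf.mul_apply, simpleRefl_apply_left, simpleRefl_apply_right] using hi)
  rw [simpleRefl_mul_cancel_right, divDiff_C, divDiffPerm_zero] at this
  exact this.symm

/-- The constant term of `A_w x^a` vanishes unless `a ∈ ℕ^n` has degree `ℓ(w)`. -/
theorem ctLin_monomial {n : ℕ} {w : SInf} (hw : InSn n w) {a : ℕ →₀ ℕ}
    (h : ctLin w (monomial a 1) ≠ 0) : a.degree = len w ∧ ∀ i, n ≤ i → a i = 0 := by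
  obtain ⟨d, hd⟩ : ∃ d, a.degree = d := ⟨_, rfl⟩
  induction d generalizing a w with
  | zero =>
    obtain rfl : a = 0 := by rwa [Finsupp.degree_eq_zero_iff] at hd
    have h1 : w = 1 := by
      by_contra h1
      refine h ?_
      change ctLin w (C 1) = 0
      rw [ctLin_apply, divDiffPerm_C h1, map_zero]
    rw [h1, len_one]
    exact ⟨rfl, fun _ _ => rfl⟩
  | succ d ih =>
    obtain ⟨j, hj⟩ : ∃ j, a j ≠ 0 := by
      by_contra! h0
      rw [show a = 0 from Finsupp.ext h0] at hd
      simp at hd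
    obtain ⟨b, rfl⟩ : ∃ b, a = b + Finsupp.single j 1 :=
      ⟨a - Finsupp.single j 1, (tsub_add_cancel_of_le (by
        rw [Finsupp.single_le_iff]; omega)).symm⟩
    have hm : (monomial (b + Finsupp.single j 1) (1 : ℚ)) = monomial b 1 * X j := by
      rw [X, monomial_mul, mul_one]
    rw [hm, ctLin_mul_X hw] at h
    obtain ⟨p, hp, hne⟩ := Finset.exists_ne_zero_of_sum_ne_zero h
    rw [ite_ne_right_iff] at hne
    obtain ⟨hlen, hne⟩ := hne
    obtain ⟨h1, h2⟩ := mem_pairs.mp hp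
    have hb : b.degree = d := by
      rw [map_add, Finsupp.degree_single] at hd
      omega
    obtain ⟨h3, h4⟩ := ih (hw.mul (inSn_transp (h1.trans h2) h2)) (right_ne_zero_of_mul hne) hb
    refine ⟨by omega, fun i hi => ?_⟩
    rw [Finsupp.add_apply, h4 i hi, zero_add, Finsupp.single_apply, if_neg]
    -- An index `j ≥ n` meets no pair below `n`, so its coefficient would vanish.
    rintro rfl
    rw [if_neg (by omega), if_neg (by omega), sub_zero, zero_mul] at hne
    exact hne rfl

/-! ### Dominant permutations -/

/-- The monomial `x_1^{c_1} ⋯ x_n^{c_n}`. -/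
noncomputable def xPow (n : ℕ) (c : ℕ → ℕ) : MvPolynomial ℕ ℚ := ∏ k ∈ Finset.range n, X k ^ c k

theorem xPow_congr {n : ℕ} {c d : ℕ → ℕ} (h : ∀ k, k < n → c k = d k) : xPow n c = xPow n d :=
  Finset.prod_congr rfl fun k hk => by rw [h k (Finset.mem_range.mp hk)]

theorem rename_xPow {n : ℕ} {u : SInf} (hu : InSn n u) (c : ℕ → ℕ) :
    rename u.1 (xPow n c) = xPow n fun k => c ((u⁻¹).1 k) := by
  rw [xPow, map_prod]
  refine Finset.prod_bij' (fun k _ => u.1 k) (fun k _ => (u⁻¹).1 k) ?_ ?_ ?_ ?_ ?_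
  · intro k hk
    exact Finset.mem_range.mpr (hu.apply_lt (Finset.mem_range.mp hk))
  · intro k hk
    exact Finset.mem_range.mpr (hu.inv.apply_lt (Finset.mem_range.mp hk))
  · intro k _
    exact SInf.inv_apply_self u k
  · intro k _
    exact SInf.apply_inv_self u k
  · intro k _
    simp only [map_pow, rename_X, SInf.inv_apply_self]

theorem xPow_eq_mul_X {n i : ℕ} (hi : i < n) {c d : ℕ → ℕ} (h1 : d i = c i + 1)
    (h2 : ∀ k, k ≠ i → d k = c k) : xPow n d = xPow n c * X i := by
  have hmem := Finset.mem_range.mpr hi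
  rw [xPow, xPow, ← Finset.mul_prod_erase _ _ hmem, ← Finset.mul_prod_erase _ _ hmem, h1]
  rw [Finset.prod_congr rfl fun k hk => by rw [h2 k (Finset.ne_of_mem_erase hk)]]
  ring

theorem divDiff_xPow_eq_zero {n i : ℕ} (hi : i + 1 < n) {c : ℕ → ℕ} (h : c i = c (i + 1)) :
    divDiff i (xPow n c) = 0 := by
  rw [divDiff_eq_zero_iff]
  refine (rename_xPow (inSn_simpleRefl hi) c).trans (xPow_congr fun k _ => ?_)
  rw [simpleRefl_inv]
  rcases eq_or_ne k i with rfl | h1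
  · rw [simpleRefl_apply_left, h]
  · rcases eq_or_ne k (i + 1) with rfl | h2
    · rw [simpleRefl_apply_right, h]
    · rw [simpleRefl_apply_of_ne h1 h2]

theorem divDiff_xPow {n i : ℕ} (hi : i + 1 < n) {c d : ℕ → ℕ} (h : c i = c (i + 1))
    (h1 : d i = c i + 1) (h2 : ∀ k, k ≠ i → d k = c k) : divDiff i (xPow n d) = xPow n c := by
  rw [xPow_eq_mul_X (by omega) h1 h2, divDiff_mul_X_left, divDiff_xPow_eq_zero hi h, zero_mul,
    zero_add]

/-- The first descent is chosen because `w` increases up to it; this is what lets 312-avoidance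
survive in `Avoids312.mul_simpleRefl`. -/
theorem exists_first_descent {w : SInf} (h : w ≠ 1) :
    ∃ i, w.1 (i + 1) < w.1 i ∧ ∀ p, p < i → w.1 p < w.1 i := by
  classical
  have hex := exists_descent h
  refine ⟨Nat.find hex, Nat.find_spec hex, ?_⟩
  have key : ∀ k, k < Nat.find hex → w.1 k < w.1 (k + 1) := fun k hk =>
    (lt_or_gt_succ w k).resolve_right (Nat.find_min hex hk)
  generalize Nat.find hex = i at key
  induction i with
  | zero => intro p hp; omega
  | succ i ih =>
    intro p hp
    have h1 := key i (Nat.lt_succ_self i)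
    rcases Nat.lt_succ_iff_lt_or_eq.mp hp with h2 | rfl
    · exact (ih (fun k hk => key k (by omega)) p h2).trans h1
    · exact h1

/-- A pattern in `w s_i` moves to one in `w` unless `s_i` reverses two of its positions. In the role
of the first two they would have to descend, but `w s_i` ascends there; in the role of the last two
they would need an earlier value above `w i`. -/
theorem Avoids312.mul_simpleRefl {n : ℕ} {w : SInf} (hav : Avoids312 n w) {i : ℕ}
    (hin : i + 1 < n) (hi : w.1 (i + 1) < w.1 i) (hp : ∀ p, p < i → w.1 p < w.1 i) :
    Avoids312 n (w * simpleRefl i) := by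
  rintro ⟨p, q, r, hpq, hqr, hr, h1, h2⟩
  simp only [SInf.mul_apply] at h1 h2
  have hlt : ∀ {a b : ℕ}, a < b → ¬ (a = i ∧ b = i + 1) →
      (simpleRefl i).1 a < (simpleRefl i).1 b := by
    intro a b hab h
    simp only [simpleRefl_apply, Equiv.swap_apply_def]
    split_ifs <;> omega
  by_cases e1 : p = i ∧ q = i + 1
  · obtain ⟨rfl, rfl⟩ := e1
    rw [simpleRefl_apply_left] at h2
    rw [simpleRefl_apply_right] at h1
    omega
  · by_cases e2 : q = i ∧ r = i + 1
    · obtain ⟨rfl, rfl⟩ := e2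
      rw [simpleRefl_apply_right, simpleRefl_apply_of_ne (by omega) (by omega)] at h2
      have := hp p hpq
      omega
    · exact hav ⟨_, _, _, hlt hpq e1, hlt hqr e2, (inSn_simpleRefl hin).apply_lt hr, h1, h2⟩

/-- The code of `w_∘ w` near the first descent of a 312-avoiding permutation `w`. -/
theorem code_longest_mul_descent {n : ℕ} {w : SInf} (hw : InSn n w) (hav : Avoids312 n w) {i : ℕ}
    (hi : w.1 (i + 1) < w.1 i) :
    code n (longest n * w) i = code n (longest n * w) (i + 1) ∧
    code n (longest n * (w * simpleRefl i)) i = code n (longest n * w) i + 1 ∧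
    ∀ k, k < n → k ≠ i →
      code n (longest n * (w * simpleRefl i)) k = code n (longest n * w) k := by
  have hin := lt_of_inversion hw (Nat.lt_succ_self i) hi
  have hw' := hw.mul (inSn_simpleRefl hin)
  -- A later value strictly between `w (i + 1)` and `w i` would complete a 312 pattern, so both
  -- positions see the same later larger values.
  have hcode : code n (longest n * w) i = code n (longest n * w) (i + 1) := by
    rw [code_longest_mul_eq hw _ (by omega), code_longest_mul_eq hw _ (by omega)]
    congr 1
    refine Finset.filter_congr fun j hj => ?_
    rw [Finset.mem_range] at hj
    constructor
    · rintro ⟨h1, h2⟩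
      rcases eq_or_ne j (i + 1) with rfl | h3
      · omega
      · exact ⟨by omega, by omega⟩
    · rintro ⟨h1, h2⟩
      refine ⟨by omega, ?_⟩
      by_contra h3
      have h4 : w.1 j ≠ w.1 i := fun h => by
        have := w.1.injective h
        omega
      exact hav ⟨i, i + 1, j, Nat.lt_succ_self i, h1, hj, h2, by omega⟩
  refine ⟨hcode, ?_, ?_⟩
  -- After the swap, position `i` holds the smaller value and additionally counts the larger one,
  -- now at `i + 1`.
  · rw [hcode, code_longest_mul_eq hw' _ (by omega), code_longest_mul_eq hw _ (by omega),
      ← Finset.card_insert_of_notMem (a := i + 1) (by simp)]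
    congr 1
    ext j
    simp only [Finset.mem_filter, Finset.mem_range, Finset.mem_insert, SInf.mul_apply,
      simpleRefl_apply_left]
    rcases eq_or_ne j (i + 1) with rfl | h1
    · simp only [simpleRefl_apply_right, true_or, iff_true]
      omega
    · rcases Nat.lt_or_ge i j with h2 | h2
      · rw [simpleRefl_apply_of_ne (by omega) h1]
        omega
      · omega
  · intro k hk hki
    rcases eq_or_ne k (i + 1) with rfl | hki'
    · rw [← hcode, code_longest_mul_eq hw' _ hk, code_longest_mul_eq hw _ (by omega)]
      congr 1
      refine Finset.filter_congr fun j hj => ?_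
      simp only [SInf.mul_apply, simpleRefl_apply_right]
      rcases eq_or_ne j (i + 1) with rfl | h1
      · omega
      · rcases Nat.lt_or_ge i j with h2 | h2
        · rw [simpleRefl_apply_of_ne (by omega) h1]
          omega
        · omega
    · rw [code_longest_mul_eq hw' _ hk, code_longest_mul_eq hw _ hk]
      have hs := inSn_simpleRefl hin
      have hself : ∀ j, (simpleRefl i).1 ((simpleRefl i).1 j) = j :=
        fun j => Equiv.swap_apply_self i (i + 1) j
      have hiff : ∀ j, k < (simpleRefl i).1 j ↔ k < j := by
        intro j
        simp only [simpleRefl_apply, Equiv.swap_apply_def]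
        split_ifs <;> omega
      refine Finset.card_bij' (fun j _ => (simpleRefl i).1 j) (fun j _ => (simpleRefl i).1 j)
        ?_ ?_ (fun j _ => hself j) (fun j _ => hself j)
      · intro j hj
        simp only [Finset.mem_filter, Finset.mem_range, SInf.mul_apply,
          simpleRefl_apply_of_ne hki hki'] at hj ⊢
        exact ⟨hs.apply_lt hj.1, (hiff j).mpr hj.2.1, hj.2.2⟩
      · intro j hj
        simp only [Finset.mem_filter, Finset.mem_range, SInf.mul_apply,
          simpleRefl_apply_of_ne hki hki', hself] at hj ⊢
        exact ⟨hs.apply_lt hj.1, (hiff j).mpr hj.2.1, hj.2.2⟩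

/-- For 312-avoiding `w ∈ S_n` the Schubert polynomial of `w_∘ w` is a monomial. -/
theorem divDiffPerm_inv_xPow_rho {n : ℕ} {w : SInf} (hw : InSn n w) (hav : Avoids312 n w) :
    divDiffPerm w⁻¹ (xPow n (rho n)) = xPow n (code n (longest n * w)) := by
  induction h : len w generalizing w with
  | zero =>
    obtain rfl := eq_one_of_len_eq_zero h
    rw [inv_one, divDiffPerm_one]
    refine xPow_congr fun k hk => ?_
    have h1 := len_eq_sum_code hw
    rw [h, eq_comm, Finset.sum_eq_zero_iff] at h1
    rw [← code_add_code hw k hk, h1 k (Finset.mem_range.mpr hk), add_zero]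
  | succ l ih =>
    have hne : w ≠ 1 := by rintro rfl; rw [len_one] at h; omega
    obtain ⟨i, hi, hp⟩ := exists_first_descent hne
    have hin := lt_of_inversion hw (Nat.lt_succ_self i) hi
    have h1 := len_mul_simpleRefl_of_gt hi
    have ih' := ih (hw.mul (inSn_simpleRefl hin)) (hav.mul_simpleRefl hin hi hp) (by omega)
    obtain ⟨h2, h3, h4⟩ := code_longest_mul_descent hw hav hi
    have h5 := divDiff_divDiffPerm_of_lt (w := (w * simpleRefl i)⁻¹) (i := i)
      (f := xPow n (rho n)) (by
        simpa only [inv_inv, SInf.mul_apply, simpleRefl_apply_left, simpleRefl_apply_right]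
          using hi)
    rw [mul_inv_rev, simpleRefl_inv, simpleRefl_mul_cancel_left] at h5
    rw [← h5, ← simpleRefl_inv i, ← mul_inv_rev, ih']
    -- `divDiff_xPow` compares exponents at all indices, whereas the codes are compared only below
    -- `n`; hence the explicit exponent function.
    rw [← divDiff_xPow hin h2 (d := fun k => if k = i then code n (longest n * w) i + 1 else
      code n (longest n * w) k) (by simp) (fun k hk => by simp [hk])]
    congr 1
    refine xPow_congr fun k hk => ?_
    rcases eq_or_ne k i with rfl | hki
    · rw [h3, if_pos rfl]
    · rw [h4 k hk hki, if_neg hki]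

theorem avoids312_longest (n : ℕ) : Avoids312 n (longest n) := by
  rintro ⟨i, j, k, hij, hjk, hk, h1, h2⟩
  rw [longest_apply_of_lt (by omega), longest_apply_of_lt (by omega)] at h1
  omega

theorem divDiffPerm_longest_xPow_rho (n : ℕ) :
    divDiffPerm (longest n) (xPow n (rho n)) = 1 := by
  have h := divDiffPerm_inv_xPow_rho (inSn_longest n) (avoids312_longest n)
  rw [longest_inv] at h
  rw [h, longest_mul_self]
  refine Finset.prod_eq_one fun k hk => ?_
  have h1 := len_eq_sum_code (inSn_one n)
  rw [len_one, eq_comm, Finset.sum_eq_zero_iff] at h1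
  rw [h1 k hk, pow_zero]

/-! ### Stability of Schubert polynomials -/

theorem schubertIn_def (n : ℕ) (w : SInf) :
    schubertIn n w = divDiffPerm (w⁻¹ * longest n) (xPow n (rho n)) := rfl

/-- The product of the long elements of `S_m` and `S_n` avoids 312, because the long element of
`S_n` decreases on its first `n` positions and is the identity afterwards. The monomial lemma then
gives the code of that element, which is `ρ` for `S_n` padded by zeros. -/
theorem divDiffPerm_longest_mul_longest {n m : ℕ} (h : n ≤ m) :
    divDiffPerm (longest n * longest m) (xPow m (rho m)) = xPow n (rho n) := by
  have hn := (inSn_longest n).mono h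
  have hin : InSn m (longest m * longest n) := (inSn_longest m).mul hn
  have hav : Avoids312 m (longest m * longest n) := by
    rintro ⟨i, j, k, hij, hjk, hk, h1, h2⟩
    have hi := hn.apply_lt (i := i) (by omega)
    have hj := hn.apply_lt (i := j) (by omega)
    have hk' := hn.apply_lt hk
    simp only [SInf.mul_apply] at h1 h2
    rw [longest_apply_of_lt hj, longest_apply_of_lt hk'] at h1
    rw [longest_apply_of_lt hi, longest_apply_of_lt hk'] at h2
    have h3 : (longest n).1 k < (longest n).1 j := by omega
    have h4 : (longest n).1 i < (longest n).1 k := by omega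
    have hkn := lt_of_inversion (inSn_longest n) hjk h3
    rw [longest_apply_of_lt hkn, longest_apply_of_lt (by omega)] at h4
    omega
  have h1 := divDiffPerm_inv_xPow_rho hin hav
  rw [mul_inv_rev, longest_inv, longest_inv, longest_mul_cancel_left] at h1
  rw [h1, xPow, xPow, ← Finset.prod_subset (Finset.range_subset_range.mpr h)]
  · refine Finset.prod_congr rfl fun k hk => ?_
    rw [Finset.mem_range] at hk
    congr 1
    rw [code, rho, show n - 1 - k = (Finset.Ioo k n).card by rw [Nat.card_Ioo]; omega]
    congr 1
    ext j
    simp only [Finset.mem_filter, Finset.mem_range, Finset.mem_Ioo, longest_apply_of_lt hk]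
    rcases Nat.lt_or_ge j n with hj | hj
    · rw [longest_apply_of_lt hj]
      omega
    · rw [inSn_longest n j hj]
      omega
  · intro k hk hk'
    rw [Finset.mem_range] at hk hk'
    rw [code, Finset.card_eq_zero.mpr, pow_zero]
    rw [Finset.filter_eq_empty_iff]
    intro j _
    rw [inSn_longest n k (by omega)]
    rintro ⟨h1, h2⟩
    rw [inSn_longest n j (by omega)] at h2
    omega

theorem len_inv_mul_longest_add {n : ℕ} {w : SInf} (hw : InSn n w) :
    len (w⁻¹ * longest n) + len w = ∑ i ∈ Finset.range n, rho n i := by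
  rw [← len_longest_mul_add hw, ← len_inv (longest n * w), mul_inv_rev, longest_inv]

/-- The operator for `S_m` factors through `divDiffPerm_longest_mul_longest`, since the lengths add.
-/
theorem schubertIn_eq {n m : ℕ} (h : n ≤ m) {w : SInf} (hw : InSn n w) :
    schubertIn m w = schubertIn n w := by
  rw [schubertIn_def, schubertIn_def, ← divDiffPerm_longest_mul_longest h,
    divDiffPerm_divDiffPerm, mul_assoc, longest_mul_cancel_left, if_pos]
  have h1 := len_inv_mul_longest_add hw
  have h2 := len_inv_mul_longest_add (hw.mono h)
  have h3 := len_inv_mul_longest_add ((inSn_longest n).mono h)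
  have h4 := len_longest_mul_add (inSn_longest n)
  rw [longest_mul_self, len_one] at h4
  rw [longest_inv] at h3
  omega

theorem schubert_eq {n : ℕ} {w : SInf} (hw : InSn n w) : schubert w = schubertIn n w := by
  classical
  have h1 : InSn (Nat.find w.2) w := Nat.find_spec w.2
  rw [schubertIn_eq (Nat.find_min' w.2 hw) h1]
  unfold schubert
  congr

/-! ### Duality and the inverse of the Schubert-Kostka matrix -/

theorem monomial_eq_xPow {n : ℕ} {a : ℕ →₀ ℕ} (ha : ∀ i, n ≤ i → a i = 0) :
    monomial a (1 : ℚ) = xPow n a := by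
  rw [monomial_eq, C_1, one_mul, xPow, Finsupp.prod]
  refine Finset.prod_subset (fun i hi => ?_) fun i _ hi => ?_
  · rw [Finset.mem_range]
    by_contra h
    exact Finsupp.mem_support_iff.mp hi (ha i (not_lt.mp h))
  · rw [Finsupp.notMem_support_iff.mp hi, pow_zero]

theorem xPow_eq_monomial (n : ℕ) (c : ℕ → ℕ) :
    ∃ a : ℕ →₀ ℕ, xPow n c = monomial a 1 ∧ (∀ i, i < n → a i = c i) ∧
      a.degree = ∑ i ∈ Finset.range n, c i := by
  classical
  have happ : ∀ i, (∑ k ∈ Finset.range n, Finsupp.single k (c k)) i = if i < n then c i else 0 := by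
    intro i
    simp [Finsupp.finsetSum_apply, Finsupp.single_apply]
  refine ⟨∑ k ∈ Finset.range n, Finsupp.single k (c k), ?_, ?_, ?_⟩
  · rw [monomial_eq_xPow fun i hi => by rw [happ, if_neg (not_lt.mpr hi)]]
    exact xPow_congr fun k hk => by rw [happ, if_pos hk]
  · intro i hi
    rw [happ, if_pos hi]
  · rw [map_sum]
    simp

theorem ctLin_xPow {n : ℕ} {w : SInf} (hw : InSn n w) {c : ℕ → ℕ}
    (h : ctLin w (xPow n c) ≠ 0) : ∑ i ∈ Finset.range n, c i = len w := by
  obtain ⟨a, ha, -, hdeg⟩ := xPow_eq_monomial n c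
  rw [ha] at h
  rw [← hdeg, (ctLin_monomial hw h).1]

theorem ctLin_longest_rho (n : ℕ) : ctLin (longest n) (xPow n (rho n)) = 1 := by
  rw [ctLin_apply, divDiffPerm_longest_xPow_rho, map_one]

open Classical in
theorem ctLin_schubert (v w : SInf) : ctLin v (schubert w) = if v = w then 1 else 0 := by
  obtain ⟨n, hv, hw⟩ : ∃ n, InSn n v ∧ InSn n w := by
    obtain ⟨n, hn⟩ := v.2
    obtain ⟨m, hm⟩ := w.2
    exact ⟨max n m, InSn.mono hn (le_max_left _ _), InSn.mono hm (le_max_right _ _)⟩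
  have hin : InSn n (v * (w⁻¹ * longest n)) := hv.mul (hw.inv.mul (inSn_longest n))
  rw [schubert_eq hw, schubertIn_def, ctLin_apply, divDiffPerm_divDiffPerm, apply_ite constantCoeff,
    ← ctLin_apply, map_zero]
  by_cases h : v = w
  · subst h
    rw [if_pos rfl, mul_inv_cancel_left, ctLin_longest_rho, if_pos]
    have h1 := len_inv_mul_longest_add hw
    have h2 := len_longest_mul_add (inSn_longest n)
    rw [longest_mul_self, len_one] at h2
    omega
  · rw [if_neg h, ite_eq_right_iff]
    intro _
    by_contra hne
    have h1 := eq_longest_of_len_eq hin (ctLin_xPow hin hne).symm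
    rw [← mul_assoc, mul_eq_right, mul_inv_eq_one] at h1
    exact h h1

/-! ### Finiteness and separation for the constant-term functionals -/

theorem ctLin_divDiff_of_lt {w : SInf} {i : ℕ} (h : w.1 i < w.1 (i + 1))
    (f : MvPolynomial ℕ ℚ) : ctLin w (divDiff i f) = ctLin (w * simpleRefl i) f := by
  rw [ctLin_apply, divDiffPerm_divDiff_of_lt h, ctLin_apply]

theorem ctLin_divDiff_of_gt {w : SInf} {i : ℕ} (h : w.1 (i + 1) < w.1 i)
    (f : MvPolynomial ℕ ℚ) : ctLin w (divDiff i f) = 0 := by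
  rw [ctLin_apply, divDiffPerm_divDiff_of_gt h, map_zero]

theorem ctLin_eq_divDiff_of_gt {w : SInf} {i : ℕ} (h : w.1 (i + 1) < w.1 i)
    (f : MvPolynomial ℕ ℚ) : ctLin w f = ctLin (w * simpleRefl i) (divDiff i f) := by
  rw [ctLin_divDiff_of_lt, simpleRefl_mul_cancel_right]
  simpa only [SInf.mul_apply, simpleRefl_apply_left, simpleRefl_apply_right] using h

/-- At a descent `i` of `w`, `ctLin w f = ctLin (w s_i) (A_i f)`. Only finitely many `A_i f` are
nonzero, and each has smaller degree. -/
theorem finite_ctLin_ne_zero (f : MvPolynomial ℕ ℚ) : {w | ctLin w f ≠ 0}.Finite := by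
  induction hd : f.totalDegree using Nat.strong_induction_on generalizing f with
  | _ d ih =>
    obtain ⟨m, hm⟩ := exists_divDiff_eq_zero f
    have hfin : ∀ i, {u | ctLin u (divDiff i f) ≠ 0}.Finite := by
      intro i
      by_cases h0 : divDiff i f = 0
      · simp [h0]
      · exact ih _ (hd ▸ totalDegree_divDiff_lt h0) _ rfl
    refine ((Set.finite_singleton 1).union ((Set.finite_lt_nat m).biUnion fun i _ =>
      (hfin i).image (· * simpleRefl i))).subset fun w hw => ?_
    by_cases h1 : w = 1
    · exact Or.inl h1
    · obtain ⟨i, hi⟩ := exists_descent h1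
      have hw' : ctLin (w * simpleRefl i) (divDiff i f) ≠ 0 := by
        rw [← ctLin_eq_divDiff_of_gt hi]; exact hw
      refine Or.inr (Set.mem_biUnion (x := i) ?_
        ⟨w * simpleRefl i, hw', simpleRefl_mul_cancel_right i w⟩)
      by_contra hmi
      rw [hm i (not_lt.mp hmi), map_zero] at hw'
      exact hw' rfl

/-- The hypothesis passes to each `A_i f`, which vanishes by induction on the degree. So `f` is
constant, and `ctLin 1` reads off the constant. -/
theorem eq_zero_of_forall_ctLin {f : MvPolynomial ℕ ℚ} (h : ∀ w, ctLin w f = 0) : f = 0 := by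
  induction hd : f.totalDegree using Nat.strong_induction_on generalizing f with
  | _ d ih =>
    have h0 : ∀ i, divDiff i f = 0 := by
      intro i
      by_contra h0
      refine h0 (ih _ (hd ▸ totalDegree_divDiff_lt h0) (fun w => ?_) rfl)
      rcases lt_or_gt_succ w i with h1 | h1
      · rw [ctLin_divDiff_of_lt h1, h]
      · rw [ctLin_divDiff_of_gt h1]
    have h1 := h 1
    rw [ctLin_apply, divDiffPerm_one] at h1
    rw [eq_C_of_forall_divDiff_eq_zero h0, h1, C_0]

theorem eq_of_forall_ctLin {f g : MvPolynomial ℕ ℚ} (h : ∀ w, ctLin w f = ctLin w g) : f = g :=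
  sub_eq_zero.mp (eq_zero_of_forall_ctLin fun w => by rw [map_sub, h, sub_self])

theorem ctLin_sum_schubert (c : SInf →₀ ℚ) (v : SInf) :
    ctLin v (∑ w ∈ c.support, c w • schubert w) = c v := by
  classical
  simp only [map_sum, map_smul, ctLin_schubert, smul_eq_mul, mul_ite, mul_one, mul_zero,
    Finset.sum_ite_eq, Finsupp.mem_support_iff]
  split_ifs with h
  · rfl
  · exact (not_not.mp h).symm

/-- The inverse of the Schubert-Kostka matrix. -/
noncomputable def invKostka (a : ℕ →₀ ℕ) : SInf →₀ ℚ :=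
  Finsupp.ofSupportFinite (fun w => ctLin w (monomial a 1)) (finite_ctLin_ne_zero _)

theorem invKostka_apply (a : ℕ →₀ ℕ) (w : SInf) : invKostka a w = ctLin w (monomial a 1) := rfl

/-- One product is the expansion of `x^a` in Schubert polynomials; the other is duality applied to
the monomial expansion of `𝔖_v`. -/
theorem isInverseKostka_invKostka : IsInverseKostka invKostka where
  inv_mul a b := by
    have h : ∑ w ∈ (invKostka a).support, invKostka a w • schubert w = monomial a 1 :=
      eq_of_forall_ctLin fun v => by rw [ctLin_sum_schubert, invKostka_apply]
    have h2 := congrArg (coeff b) h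
    rw [coeff_sum, coeff_monomial] at h2
    simpa only [coeff_smul, smul_eq_mul, kostka] using h2
  mul_inv v w := by
    classical
    have h : ctLin w (schubert v) = if v = w then 1 else 0 := by
      rw [ctLin_schubert]
      simp only [eq_comm]
    rw [← h]
    conv_rhs => rw [(schubert v).as_sum, map_sum]
    refine Finset.sum_congr rfl fun a _ => ?_
    rw [invKostka_apply, kostka, ← smul_eq_mul, ← map_smul, smul_monomial, smul_eq_mul, mul_one]

/-- The identity `L K = 1` says that row `a` of `L` expands `x^a` in Schubert polynomials, and
duality recovers the coefficients. -/
theorem IsInverseKostka.eq_invKostka {L : (ℕ →₀ ℕ) → (SInf →₀ ℚ)} (h : IsInverseKostka L) :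
    L = invKostka := by
  funext a
  refine Finsupp.ext fun v => ?_
  have h1 : ∑ w ∈ (L a).support, L a w • schubert w = monomial a 1 := by
    ext b
    rw [coeff_sum, coeff_monomial]
    simpa only [coeff_smul, smul_eq_mul, kostka] using h.inv_mul a b
  rw [invKostka_apply, ← h1, ctLin_sum_schubert]

theorem existsUnique_isInverseKostka :
    ∃! L : (ℕ →₀ ℕ) → (SInf →₀ ℚ), IsInverseKostka L :=
  ⟨invKostka, isInverseKostka_invKostka, fun _ h => h.eq_invKostka⟩

/-! ### The entries of the inverse matrix at 312-avoiding permutations -/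

theorem longest_descent {n i : ℕ} (hi : i + 1 < n) :
    (longest n).1 (i + 1) < (longest n).1 i := by
  rw [longest_apply_of_lt hi, longest_apply_of_lt (by omega)]
  omega

/-- Every `i` is a descent of `w_∘`, so both sides equal `ctLin (w_∘ s_i) (A_i f · A_i g)`. -/
theorem ctLin_longest_divDiff_mul {n i : ℕ} (hi : i + 1 < n) (f g : MvPolynomial ℕ ℚ) :
    ctLin (longest n) (divDiff i f * g) = ctLin (longest n) (f * divDiff i g) := by
  rw [ctLin_eq_divDiff_of_gt (longest_descent hi), divDiff_divDiff_mul,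
    ctLin_eq_divDiff_of_gt (longest_descent hi) (f * _), divDiff_mul_divDiff]

theorem ctLin_longest_divDiffPerm_mul {n : ℕ} {w : SInf} (hw : InSn n w)
    (f g : MvPolynomial ℕ ℚ) :
    ctLin (longest n) (divDiffPerm w f * g) = ctLin (longest n) (f * divDiffPerm w⁻¹ g) := by
  refine InSn.descent_induction (n := n) (P := fun w => ∀ f, ctLin (longest n) (divDiffPerm w f * g)
    = ctLin (longest n) (f * divDiffPerm w⁻¹ g)) ?_ ?_ hw f
  · intro f
    rw [inv_one, divDiffPerm_one, divDiffPerm_one]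
  · intro w i hi _ h ih f
    rw [← divDiffPerm_divDiff_of_lt h, ih, ctLin_longest_divDiff_mul hi,
      divDiff_divDiffPerm_of_lt (by rwa [inv_inv]), mul_inv_rev, simpleRefl_inv]

/-- Already `x^ρ` has degree `ℓ(w_∘)`, so any further factor of positive degree is invisible to the
functional. -/
theorem ctLin_longest_mul_rho (n : ℕ) (g : MvPolynomial ℕ ℚ) :
    ctLin (longest n) (g * xPow n (rho n)) = constantCoeff g := by
  classical
  induction g using MvPolynomial.induction_on' with
  | monomial u a =>
    rw [constantCoeff_monomial]
    split_ifs with hu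
    · subst hu
      have h : (monomial 0 a : MvPolynomial ℕ ℚ) = C a := rfl
      rw [h, ← smul_eq_C_mul, map_smul, ctLin_longest_rho, smul_eq_mul, mul_one]
    · obtain ⟨r, hr, -, hdeg⟩ := xPow_eq_monomial n (rho n)
      rw [hr, monomial_mul, mul_one, ← mul_one a, ← smul_eq_mul, ← smul_monomial, map_smul]
      by_contra hne
      have h1 := (ctLin_monomial (inSn_longest n) (right_ne_zero_of_mul hne)).1
      have h2 := len_longest_mul_add (inSn_longest n)
      rw [longest_mul_self, len_one] at h2
      rw [map_add] at h1
      exact hu ((Finsupp.degree_eq_zero_iff u).mp (by omega))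
  | add p q hp hq => rw [add_mul, map_add, hp, hq, map_add]

theorem ctLin_eq_ctLin_longest {n : ℕ} {w : SInf} (hw : InSn n w) (f : MvPolynomial ℕ ℚ) :
    ctLin w f = ctLin (longest n) (f * divDiffPerm w⁻¹ (xPow n (rho n))) := by
  rw [← ctLin_longest_divDiffPerm_mul hw, ctLin_longest_mul_rho, ctLin_apply]

theorem xPow_mul_xPow (n : ℕ) (c d : ℕ → ℕ) :
    xPow n c * xPow n d = xPow n fun k => c k + d k := by
  simp only [xPow, ← Finset.prod_mul_distrib, pow_add]

theorem ctLin_xPow_of_avoids312 {n : ℕ} {w : SInf} (hw : InSn n w) (hav : Avoids312 n w)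
    (a : ℕ → ℕ) : ctLin w (xPow n a)
      = ctLin (longest n) (xPow n fun k => a k + code n (longest n * w) k) := by
  rw [ctLin_eq_ctLin_longest hw, divDiffPerm_inv_xPow_rho hw hav, xPow_mul_xPow]

theorem ctLin_longest_rename_simpleRefl {n i : ℕ} (hi : i + 1 < n) (f : MvPolynomial ℕ ℚ) :
    ctLin (longest n) (rename (simpleRefl i).1 f) = -ctLin (longest n) f := by
  rw [ctLin_eq_divDiff_of_gt (longest_descent hi) f,
    ctLin_eq_divDiff_of_gt (longest_descent hi), ← map_neg]
  exact congrArg _ (divDiff_rename_swap i f)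

theorem rename_mul_apply (u v : SInf) (f : MvPolynomial ℕ ℚ) :
    rename (u * v).1 f = rename u.1 (rename v.1 f) := by
  rw [rename_rename]
  rfl

theorem ctLin_longest_rename {n : ℕ} {u : SInf} (hu : InSn n u) (f : MvPolynomial ℕ ℚ) :
    ctLin (longest n) (rename u.1 f) = (-1) ^ len u * ctLin (longest n) f := by
  refine InSn.descent_induction (n := n) (P := fun u => ∀ f, ctLin (longest n) (rename u.1 f)
    = (-1) ^ len u * ctLin (longest n) f) ?_ ?_ hu f
  · intro f
    rw [len_one, pow_zero, one_mul]
    exact congrArg _ (rename_id_apply f)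
  · intro w i hi _ h ih f
    rw [rename_mul_apply, ih, ctLin_longest_rename_simpleRefl hi, len_mul_simpleRefl_of_lt h]
    ring

theorem transp_add_two (i d : ℕ) :
    transp i (i + d + 2) = simpleRefl (i + d + 1) * (transp i (i + d + 1) * simpleRefl (i + d + 1)) := by
  refine SInf.ext_apply fun k => ?_
  simp only [SInf.mul_apply, simpleRefl_apply, transp_apply, Equiv.swap_apply_def]
  split_ifs <;> omega

/-- Conjugating by a simple reflection costs two signs, so the sign of a transposition needs no
computation of its length. -/
theorem ctLin_longest_rename_transp {n i j : ℕ} (hij : i < j) (hj : j < n)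
    (f : MvPolynomial ℕ ℚ) :
    ctLin (longest n) (rename (transp i j).1 f) = -ctLin (longest n) f := by
  obtain ⟨d, rfl⟩ := Nat.exists_eq_add_of_lt hij
  induction d generalizing f with
  | zero => exact ctLin_longest_rename_simpleRefl hj f
  | succ d ih =>
    rw [← add_assoc, show i + d + 1 + 1 = i + d + 2 from rfl, transp_add_two, rename_mul_apply,
      rename_mul_apply, ctLin_longest_rename_simpleRefl (by omega), ih _ (by omega) (by omega),
      ctLin_longest_rename_simpleRefl (by omega), neg_neg]

/-- A monomial with a repeated exponent is fixed by a transposition, while the functional changes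
sign. -/
theorem injOn_of_ctLin_longest_xPow_ne_zero {n : ℕ} {b : ℕ → ℕ}
    (h : ctLin (longest n) (xPow n b) ≠ 0) : Set.InjOn b (Finset.range n) := by
  have key : ∀ i j, i < j → j < n → b i ≠ b j := by
    intro i j hij hj hb
    have h1 := ctLin_longest_rename_transp hij hj (xPow n b)
    rw [rename_xPow (inSn_transp (by omega) hj)] at h1
    rw [xPow_congr (d := b)] at h1
    · exact h (by linarith)
    · intro k _
      rw [transp_inv, transp_apply]
      rcases eq_or_ne k i with rfl | h1
      · rw [Equiv.swap_apply_left, hb]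
      · rcases eq_or_ne k j with rfl | h2
        · rw [Equiv.swap_apply_right, hb]
        · rw [Equiv.swap_apply_of_ne_of_ne h1 h2]
  intro i hi j hj hb
  rw [Finset.mem_coe, Finset.mem_range] at hi hj
  by_contra hne
  rcases lt_or_gt_of_ne hne with h1 | h1
  · exact key i j h1 hj hb
  · exact key j i h1 hi hb.symm

/-- Exchanging missing elements, all `< n`, for equally many elements `≥ n` would raise the sum. -/
theorem eq_range_of_card_of_sum {n : ℕ} {s : Finset ℕ} (hc : s.card = n)
    (hs : ∑ i ∈ s, i = ∑ i ∈ Finset.range n, i) : s = Finset.range n := by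
  by_contra hne
  have h0 : (s \ Finset.range n).Nonempty := by
    rw [Finset.sdiff_nonempty]
    intro hsub
    exact hne (Finset.eq_of_subset_of_card_le hsub (by rw [hc, Finset.card_range]))
  have hcard : (s \ Finset.range n).card = (Finset.range n \ s).card :=
    Finset.card_sdiff_comm (by rw [hc, Finset.card_range])
  have h1 : (s \ Finset.range n).card • n ≤ ∑ i ∈ s \ Finset.range n, i :=
    Finset.card_nsmul_le_sum _ _ _ fun i hi => by
      rw [Finset.mem_sdiff, Finset.mem_range] at hi
      omega
  have h2 : ∑ i ∈ Finset.range n \ s, i < (Finset.range n \ s).card • n := by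
    rw [← Finset.sum_const]
    refine Finset.sum_lt_sum_of_nonempty ?_ fun i hi => ?_
    · rw [← Finset.card_pos, ← hcard, Finset.card_pos]
      exact h0
    · rw [Finset.mem_sdiff, Finset.mem_range] at hi
      omega
  have h3 := Finset.sum_inter_add_sum_sdiff s (Finset.range n) (fun i => i)
  have h4 := Finset.sum_inter_add_sum_sdiff (Finset.range n) s (fun i => i)
  rw [Finset.inter_comm] at h4
  rw [hcard] at h1
  omega

theorem exists_perm_of_injOn {n : ℕ} {b : ℕ → ℕ} (hb : Set.InjOn b (Finset.range n))
    (hs : ∑ i ∈ Finset.range n, b i = ∑ i ∈ Finset.range n, rho n i) :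
    ∃ u : SInf, InSn n u ∧ ∀ i, i < n → b i = rho n ((u⁻¹).1 i) := by
  have himg : (Finset.range n).image b = Finset.range n := by
    refine eq_range_of_card_of_sum ?_ ?_
    · rw [Finset.card_image_of_injOn hb, Finset.card_range]
    · rw [Finset.sum_image hb, hs]
      exact Finset.sum_range_reflect (fun i => i) n
  have hlt : ∀ i, i < n → b i < n := fun i hi => by
    rw [← Finset.mem_range, ← himg]
    exact Finset.mem_image_of_mem b (Finset.mem_range.mpr hi)
  -- As `ρ_k = n - 1 - k`, solving `b i = ρ (u⁻¹ i)` forces `u⁻¹ i = n - 1 - b i`.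
  have hbij : Function.Bijective fun i => if i < n then n - 1 - b i else i := by
    constructor
    · intro i j hij
      simp only at hij
      split_ifs at hij with h1 h2 h2
      · have h3 := hlt i h1
        have h4 := hlt j h2
        exact hb (Finset.mem_coe.mpr (Finset.mem_range.mpr h1))
          (Finset.mem_coe.mpr (Finset.mem_range.mpr h2)) (by omega)
      · omega
      · omega
      · exact hij
    · intro k
      by_cases hk : k < n
      · have h1 : n - 1 - k ∈ (Finset.range n).image b := by
          rw [himg, Finset.mem_range]; omega
        obtain ⟨i, hi, hbi⟩ := Finset.mem_image.mp h1
        refine ⟨i, ?_⟩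
        simp only [if_pos (Finset.mem_range.mp hi), hbi]
        omega
      · exact ⟨k, by simp only [if_neg hk]⟩
  have hfix : ∀ i, n ≤ i → Equiv.ofBijective _ hbij i = i := fun i hi => if_neg (not_lt.mpr hi)
  let v : SInf := ⟨Equiv.ofBijective _ hbij, n, hfix⟩
  have hv : InSn n v := hfix
  refine ⟨v⁻¹, hv.inv, fun i hi => ?_⟩
  rw [inv_inv]
  have h1 : v.1 i = n - 1 - b i := if_pos hi
  have h2 := hlt i hi
  rw [h1, rho]
  omega

theorem ctLin_longest_xPow_of_perm {n : ℕ} {b : ℕ → ℕ} {u : SInf} (hu : InSn n u)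
    (h : ∀ i, i < n → b i = rho n ((u⁻¹).1 i)) :
    ctLin (longest n) (xPow n b) = (-1) ^ len u := by
  rw [xPow_congr h, ← rename_xPow hu, ctLin_longest_rename hu, ctLin_longest_rho, mul_one]

theorem ctLin_longest_xPow_of_not_perm {n : ℕ} {b : ℕ → ℕ}
    (h : ¬ ∃ u : SInf, InSn n u ∧ ∀ i, i < n → b i = rho n ((u⁻¹).1 i)) :
    ctLin (longest n) (xPow n b) = 0 := by
  by_contra hne
  refine h (exists_perm_of_injOn (injOn_of_ctLin_longest_xPow_ne_zero hne) ?_)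
  have h2 := len_longest_mul_add (inSn_longest n)
  rw [longest_mul_self, len_one, zero_add] at h2
  rw [ctLin_xPow (inSn_longest n) hne, h2]

/-! ### Saturated chains -/

theorem transp_injective {i j k l : ℕ} (h1 : i < j) (h2 : k < l)
    (h : transp i j = transp k l) : (i, j) = (k, l) := by
  have e1 : (transp i j).1 i = j := Equiv.swap_apply_left i j
  have e2 : (transp i j).1 j = i := Equiv.swap_apply_right i j
  rw [h, transp_apply, Equiv.swap_apply_def] at e1 e2
  rw [Prod.mk.injEq]
  split_ifs at e1 e2 <;> omega

theorem edgeWeight_mul_transp (u : SInf) {i j : ℕ} (hij : i < j) :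
    edgeWeight u (u * transp i j) = X i - X j := by
  have h : {p : ℕ × ℕ | p.1 < p.2 ∧ u * transp i j = u * transp p.1 p.2} = {(i, j)} := by
    ext ⟨k, l⟩
    constructor
    · rintro ⟨h1, h2⟩
      exact (transp_injective hij h1 (mul_left_cancel h2)).symm
    · rintro h
      obtain ⟨rfl, rfl⟩ := Prod.mk.inj h
      exact ⟨hij, rfl⟩
  rw [edgeWeight, h, finsum_mem_singleton]

/-- The saturated chains of length `l` from the identity to `w` in `S_n`. -/
def chainSet (n l : ℕ) (w : SInf) : Set (Fin (l + 1) → SInf) :=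
  {c | (∀ k, InSn n (c k)) ∧ c 0 = 1 ∧ c (Fin.last l) = w ∧
    ∀ k : Fin l, Covers (c k.castSucc) (c k.succ)}

/-- The weighted sum over the saturated chains of length `l` from the identity to `w`. -/
noncomputable def chainSum (n l : ℕ) (w : SInf) : MvPolynomial ℕ ℚ :=
  ∑ᶠ c ∈ chainSet n l w, ∏ k : Fin l, edgeWeight (c k.castSucc) (c k.succ)

/-- In `chainSum` the number of steps is a free parameter rather than `len w`, which permits
induction on it. -/
theorem degPoly_eq (n : ℕ) (w : SInf) :
    degPoly n w = C (1 / ((len w).factorial : ℚ)) * chainSum n (len w) w := rfl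

theorem chainSet_zero (n : ℕ) : chainSet n 0 1 = {fun _ => 1} := by
  ext c
  constructor
  · rintro ⟨-, h, -⟩
    funext k
    exact (congrArg c (Fin.eq_zero k)).trans h
  · rintro rfl
    exact ⟨fun _ => inSn_one n, rfl, rfl, fun k => k.elim0⟩

theorem chainSum_zero (n : ℕ) : chainSum n 0 1 = 1 := by
  rw [chainSum, chainSet_zero, finsum_mem_singleton]
  rfl

/-- The pairs `(a, b)` such that `w * transp a b` is covered by `w`. -/
noncomputable def coverPairs (n : ℕ) (w : SInf) : Finset (ℕ × ℕ) :=
  (pairs n).filter fun p => len (w * transp p.1 p.2) + 1 = len w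

theorem mem_coverPairs {n : ℕ} {w : SInf} {p : ℕ × ℕ} :
    p ∈ coverPairs n w ↔ (p.1 < p.2 ∧ p.2 < n) ∧ len (w * transp p.1 p.2) + 1 = len w := by
  rw [coverPairs, Finset.mem_filter, mem_pairs]

/-- Chains are sorted by their last cover; its pair is an inversion of `w`, hence lies below `n`. -/
theorem chainSet_succ {n : ℕ} (l : ℕ) {w : SInf} (hw : InSn n w) :
    chainSet n (l + 1) w = ⋃ p ∈ (coverPairs n w : Set (ℕ × ℕ)),
      (fun c => (Fin.snoc c w : Fin (l + 1 + 1) → SInf)) ''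
        chainSet n l (w * transp p.1 p.2) := by
  ext c
  simp only [Set.mem_iUnion]
  constructor
  · rintro ⟨h1, h2, h3, h4⟩
    have h5 := h4 (Fin.last l)
    rw [Fin.succ_last, h3] at h5
    obtain ⟨⟨i, j, hij, hu⟩, hlen⟩ := h5
    have hu' : c (Fin.last l).castSucc = w * transp i j := by
      rw [hu, transp_mul_cancel_right]
    rw [hu'] at hlen
    have hinv : w.1 j < w.1 i := by
      by_contra h
      have hne : w.1 i ≠ w.1 j := fun h' => hij.ne (w.1.injective h')
      have := len_lt_len_mul_transp (w := w) hij (by omega)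
      omega
    refine ⟨(i, j), Finset.mem_coe.mpr (mem_coverPairs.mpr
      ⟨⟨hij, lt_of_inversion hw hij hinv⟩, hlen.symm⟩), Fin.init c,
      ⟨fun k => h1 _, h2, hu', fun k => h4 k.castSucc⟩, ?_⟩
    have h6 := Fin.snoc_init_self c
    rw [h3] at h6
    exact h6
  · rintro ⟨p, hp, c, ⟨h1, h2, h3, h4⟩, rfl⟩
    obtain ⟨⟨hp1, hp2⟩, hp3⟩ := mem_coverPairs.mp (Finset.mem_coe.mp hp)
    refine ⟨fun k => ?_, ?_, ?_, fun k => ?_⟩ <;> beta_reduce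
    · refine Fin.lastCases ?_ (fun k => ?_) k
      · rw [Fin.snoc_last]; exact hw
      · rw [Fin.snoc_castSucc]; exact h1 k
    · have h5 := Fin.snoc_castSucc (α := fun _ => SInf) (n := l + 1) w c 0
      exact h5.trans h2
    · rw [Fin.snoc_last]
    · refine Fin.lastCases ?_ (fun k => ?_) k
      · rw [Fin.succ_last, Fin.snoc_last, Fin.snoc_castSucc, h3]
        exact ⟨⟨p.1, p.2, hp1, (transp_mul_cancel_right _ _ w).symm⟩, hp3.symm⟩
      · rw [Fin.succ_castSucc, Fin.snoc_castSucc, Fin.snoc_castSucc]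
        exact h4 k

theorem inSn_mul_transp_of_mem {n : ℕ} {w : SInf} (hw : InSn n w) {p : ℕ × ℕ}
    (hp : p ∈ coverPairs n w) : InSn n (w * transp p.1 p.2) := by
  obtain ⟨⟨h1, h2⟩, -⟩ := mem_coverPairs.mp hp
  exact hw.mul (inSn_transp (h1.trans h2) h2)

theorem chainSet_finite (n l : ℕ) {w : SInf} (hw : InSn n w) : (chainSet n l w).Finite := by
  induction l generalizing w with
  | zero =>
    refine (Set.finite_singleton (fun _ => w)).subset ?_
    rintro c ⟨-, -, h, -⟩
    refine funext fun k => ?_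
    exact (congrArg c (Fin.eq_zero k)).trans h
  | succ l ih =>
    rw [chainSet_succ l hw]
    exact (Finset.finite_toSet _).biUnion fun p hp =>
      (ih (inSn_mul_transp_of_mem hw (Finset.mem_coe.mp hp))).image _

theorem chainSum_succ {n : ℕ} (l : ℕ) {w : SInf} (hw : InSn n w) :
    chainSum n (l + 1) w
      = ∑ p ∈ coverPairs n w, chainSum n l (w * transp p.1 p.2) * (X p.1 - X p.2) := by
  have hsnoc : Function.Injective fun c => (Fin.snoc c w : Fin (l + 1 + 1) → SInf) := by
    intro c d h
    have := congrArg Fin.init h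
    simpa only [Fin.init_snoc] using this
  rw [chainSum, chainSet_succ l hw, finsum_mem_biUnion _ (Finset.finite_toSet _),
    finsum_mem_coe_finset]
  · refine Finset.sum_congr rfl fun p hp => ?_
    have hfin := chainSet_finite n l (inSn_mul_transp_of_mem hw hp)
    rw [finsum_mem_image hsnoc.injOn, chainSum, finsum_mem_mul' _ _ hfin]
    refine finsum_mem_congr rfl fun c hc => ?_
    obtain ⟨⟨h1, -⟩, -⟩ := mem_coverPairs.mp hp
    have hlast : edgeWeight (w * transp p.1 p.2) w = X p.1 - X p.2 := by
      have := edgeWeight_mul_transp (w * transp p.1 p.2) h1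
      rwa [transp_mul_cancel_right] at this
    rw [Fin.prod_univ_castSucc, Fin.succ_last, Fin.snoc_last, Fin.snoc_castSucc, hc.2.2.1, hlast]
    congr 1
    refine Finset.prod_congr rfl fun k _ => ?_
    rw [Fin.succ_castSucc, Fin.snoc_castSucc, Fin.snoc_castSucc]
  · exact fun p hp =>
      (chainSet_finite n l (inSn_mul_transp_of_mem hw (Finset.mem_coe.mp hp))).image _
  -- A chain determines its penultimate element `w * transp p.1 p.2`, and hence `p`.
  · intro p hp q hq hne
    refine Set.disjoint_left.mpr ?_
    rintro _ ⟨c, hc, rfl⟩ ⟨d, hd, hcd⟩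
    obtain rfl := hsnoc hcd
    refine hne (transp_injective (mem_coverPairs.mp hp).1.1 (mem_coverPairs.mp hq).1.1 ?_)
    exact mul_left_cancel (hc.2.2.1.symm.trans hd.2.2.1)

/-! ### Degree polynomials -/

/-- The linear form `y_1 x_1 + ⋯ + y_n x_n`. -/
noncomputable def linForm (n : ℕ) (y : ℕ → ℚ) : MvPolynomial ℕ ℚ :=
  ∑ i ∈ Finset.range n, C (y i) * X i

theorem ctLin_mul_linForm {n : ℕ} {w : SInf} (hw : InSn n w) (y : ℕ → ℚ)
    (f : MvPolynomial ℕ ℚ) : ctLin w (f * linForm n y)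
      = ∑ p ∈ coverPairs n w, ctLin (w * transp p.1 p.2) f * (y p.1 - y p.2) := by
  have h : f * linForm n y = ∑ i ∈ Finset.range n, y i • (f * X i) := by
    rw [linForm, Finset.mul_sum]
    exact Finset.sum_congr rfl fun i _ => by rw [smul_eq_C_mul]; ring
  rw [h, map_sum]
  simp only [map_smul, ctLin_mul_X hw, ← Finset.sum_filter, smul_eq_mul, Finset.mul_sum]
  rw [Finset.sum_comm]
  refine Finset.sum_congr rfl fun p hp => ?_
  obtain ⟨⟨h1, h2⟩, -⟩ := mem_coverPairs.mp hp
  have e1 : p.1 ∈ Finset.range n := Finset.mem_range.mpr (h1.trans h2)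
  have e2 : p.2 ∈ Finset.range n := Finset.mem_range.mpr h2
  simp only [← mul_assoc, ← Finset.sum_mul, mul_sub, mul_ite, mul_one, mul_zero,
    Finset.sum_sub_distrib, Finset.sum_ite_eq', e1, e2, if_true]
  ring

/-- Both sides satisfy the recursion over covers of `ctLin_mul_linForm`. The `y_i` are specialised
to rationals because `ctLin` is only `ℚ`-linear. -/
theorem eval_chainSum {n l : ℕ} {w : SInf} (hw : InSn n w) (hl : len w = l) (y : ℕ → ℚ) :
    eval y (chainSum n l w) = ctLin w (linForm n y ^ l) := by
  induction l generalizing w with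
  | zero =>
    obtain rfl := eq_one_of_len_eq_zero hl
    rw [chainSum_zero, pow_zero, ctLin_apply, divDiffPerm_one, map_one, map_one]
  | succ l ih =>
    rw [chainSum_succ l hw, pow_succ, ctLin_mul_linForm hw, map_sum]
    refine Finset.sum_congr rfl fun p hp => ?_
    have h := (mem_coverPairs.mp hp).2
    rw [map_mul, ih (inSn_mul_transp_of_mem hw hp) (by omega), map_sub, eval_X, eval_X]

theorem linForm_pow (n l : ℕ) (y : ℕ → ℚ) :
    linForm n y ^ l = ∑ a ∈ (Finset.range n).finsuppAntidiag l,
      (Nat.multinomial (Finset.range n) a * ∏ i ∈ Finset.range n, y i ^ a i : ℚ)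
        • monomial a 1 := by
  rw [linForm, Finset.sum_pow_eq_sum_piAntidiag]
  symm
  refine Finset.sum_bij (fun a _ => (a : ℕ → ℕ)) ?_ ?_ ?_ ?_
  · intro a ha
    rw [Finset.mem_finsuppAntidiag] at ha
    rw [Finset.mem_piAntidiag]
    exact ⟨ha.1, fun i hi => ha.2 (Finsupp.mem_support_iff.mpr hi)⟩
  · intro a _ b _ h
    exact DFunLike.coe_injective h
  · intro f hf
    rw [Finset.mem_piAntidiag] at hf
    refine ⟨Finsupp.onFinset (Finset.range n) f hf.2, ?_, rfl⟩
    rw [Finset.mem_finsuppAntidiag]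
    exact ⟨hf.1, Finsupp.support_onFinset_subset⟩
  · intro a ha
    rw [Finset.mem_finsuppAntidiag] at ha
    rw [monomial_eq_xPow (n := n) (a := a) fun i hi => by
      by_contra h
      have := Finset.mem_range.mp (ha.2 (Finsupp.mem_support_iff.mpr h))
      omega]
    simp only [mul_pow, Finset.prod_mul_distrib, smul_eq_C_mul, map_mul, map_natCast, map_prod,
      map_pow, xPow, mul_assoc]

theorem invKostka_ne_zero {n : ℕ} {w : SInf} (hw : InSn n w) {a : ℕ →₀ ℕ}
    (h : invKostka a w ≠ 0) : a ∈ (Finset.range n).finsuppAntidiag (len w) := by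
  obtain ⟨h1, h2⟩ := ctLin_monomial hw h
  have hsub : a.support ⊆ Finset.range n := fun i hi => by
    rw [Finset.mem_range]
    by_contra h
    exact Finsupp.mem_support_iff.mp hi (h2 i (not_lt.mp h))
  rw [Finset.mem_finsuppAntidiag]
  refine ⟨?_, hsub⟩
  rw [← h1, Finsupp.degree_apply]
  exact (Finset.sum_subset hsub fun i _ hi => Finsupp.notMem_support_iff.mp hi).symm

theorem finite_invKostka_ne_zero {n : ℕ} {w : SInf} (hw : InSn n w) :
    {a : ℕ →₀ ℕ | invKostka a w ≠ 0}.Finite :=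
  (Finset.finite_toSet ((Finset.range n).finsuppAntidiag (len w))).subset
    fun _ ha => Finset.mem_coe.mpr (invKostka_ne_zero hw ha)

theorem eval_divPow {n : ℕ} {a : ℕ →₀ ℕ} (ha : a.support ⊆ Finset.range n) (y : ℕ → ℚ) :
    eval y (divPow a) = ∏ i ∈ Finset.range n, 1 / ((a i).factorial : ℚ) * y i ^ a i := by
  rw [divPow, Finsupp.prod, map_prod]
  simp only [map_mul, map_pow, eval_C, eval_X]
  exact Finset.prod_subset ha fun i _ hi => by
    rw [Finsupp.notMem_support_iff.mp hi]; simp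

/-- The entries of the inverse Schubert-Kostka matrix are the coefficients of `𝔇_w` in the basis
of divided powers. -/
theorem degPoly_eq_finsum {n : ℕ} {w : SInf} (hw : InSn n w) :
    degPoly n w = ∑ᶠ a : ℕ →₀ ℕ, invKostka a w • divPow a := by
  rw [finsum_eq_sum_of_support_subset (s := (Finset.range n).finsuppAntidiag (len w))]
  -- Over the infinite field `ℚ`, agreement at all points gives equality of polynomials.
  · refine MvPolynomial.funext fun y => ?_
    rw [degPoly_eq, map_mul, eval_C, eval_chainSum hw rfl, linForm_pow, map_sum, map_sum,
      Finset.mul_sum]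
    refine Finset.sum_congr rfl fun a ha => ?_
    rw [Finset.mem_finsuppAntidiag] at ha
    rw [map_smul, smul_eval, eval_divPow ha.2, invKostka_apply, Finset.prod_mul_distrib,
      smul_eq_mul]
    -- The factor `1 / ℓ(w)!` turns the multinomial coefficient into `∏ 1 / a_i!`, the normalisation
    -- of `divPow`.
    have h1 := Nat.multinomial_spec (Finset.range n) a
    rw [ha.1] at h1
    have h2 : (∏ i ∈ Finset.range n, ((a i).factorial : ℚ))
        * Nat.multinomial (Finset.range n) a = (len w).factorial := by
      exact_mod_cast h1
    have h3 : (∏ i ∈ Finset.range n, ((a i).factorial : ℚ)) ≠ 0 :=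
      Finset.prod_ne_zero_iff.mpr fun i _ => Nat.cast_ne_zero.mpr (Nat.factorial_ne_zero _)
    have h4 : (Nat.multinomial (Finset.range n) a : ℚ) ≠ 0 := by
      intro h
      rw [h, mul_zero] at h2
      exact Nat.cast_ne_zero.mpr (Nat.factorial_ne_zero _) h2.symm
    rw [← h2]
    simp only [one_div, Finset.prod_inv_distrib]
    field_simp
  · intro a ha
    refine Finset.mem_coe.mpr (invKostka_ne_zero hw fun h => ?_)
    rw [Function.mem_support, h, zero_smul] at ha
    exact ha rfl

end SchubertKostka

theorem mainTheorem10 (n : ℕ) (w : SInf) (hw : InSn n w) (hav : Avoids312 n w) :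
    -- the Schubert-Kostka matrix has a unique inverse, and for this inverse:
    (∃! L : (ℕ →₀ ℕ) → (SInf →₀ ℚ), IsInverseKostka L) ∧
    ∀ Kinv : (ℕ →₀ ℕ) → (SInf →₀ ℚ), IsInverseKostka Kinv →
      (∀ a : ℕ →₀ ℕ, (∀ i, n ≤ i → a i = 0) →
        (∀ u : SInf, InSn n u →
          (∀ i, i < n → a i + code n (longest n * w) i = rho n (u⁻¹.1 i)) →
            Kinv a w = (-1) ^ len u) ∧
        ((¬ ∃ u : SInf, InSn n u ∧
          ∀ i, i < n → a i + code n (longest n * w) i = rho n (u⁻¹.1 i)) →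
            Kinv a w = 0)) ∧
      {a : ℕ →₀ ℕ | Kinv a w ≠ 0}.Finite ∧
      degPoly n w = ∑ᶠ a : ℕ →₀ ℕ, Kinv a w • divPow a := by
  refine ⟨existsUnique_isInverseKostka, fun Kinv hK => ?_⟩
  rw [hK.eq_invKostka]
  refine ⟨fun a ha => ?_, finite_invKostka_ne_zero hw, degPoly_eq_finsum hw⟩
  rw [invKostka_apply, monomial_eq_xPow ha, ctLin_xPow_of_avoids312 hw hav]
  exact ⟨fun u hu h => ctLin_longest_xPow_of_perm hu h, ctLin_longest_xPow_of_not_perm⟩
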